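/- A deterministic tree-walking-storage automaton (TWSDA) has a finite state set $Q$, a finite input alphabet $\Sigma$, an endmarker $\triangleright\notin\Sigma$, a finite set $\Gamma$ of tree symbols, a root symbol $\bot\notin\Gamma$, an initial state and a set of accepting states. Its storage is a finite binary tree whose root is labelled $\bot$ and whose other nodes are labelled by $\Gamma$, together with a pointer to a node; initially the tree consists of the root only. A partial transition function maps the current state, the next input symbol from $\Sigma\cup\{\triangleright\}$ or the empty word $\lambda$ (where, for the same other arguments, it is never defined both for $\lambda$ and for an input symbol), the type of the current node (whether it is the root, a left or a right descendant; whether it has a left and whether it has a right descendant) and the label of the current node to a new state and one operation: move the pointer up, stay, move it to the left or right descendant, remove the current non-root leaf and move up (pop), or append a new left or right descendant labelled by a symbol of $\Gamma$ and move to it (push). Only operations that are possible at a node of the given type are prescribed. A word $w\in\Sigma^*$ is accepted if, started with unread input $w\triangleright$, the automaton halts (no transition is defined) in an accepting state after having read $w\triangleright$ entirely. It is non-erasing (TWSDNEA) if it never pops, and works in real time if no transition is defined for $\lambda$. Let $\mathscr{L}_{rt}(\mathrm{TWSDA})$ and $\mathscr{L}_{rt}(\mathrm{TWSDNEA})$ be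 the families of languages over finite alphabets accepted by TWSDAs, respectively TWSDNEAs, that work in real time. Over the alphabet $\{a,b,\$,\text{¢},\#_1,\#_2\}$ let $$\hat L_p=\{\,x_1\$^{|x_1|}x_2\$^{|x_2|}\cdots x_k\$^{|x_k|}\,\text{¢}\,z\,\#_1\,y \mid k\ge 0,\ x_i\in\{a,b\}^*\ (1\le i\le k),\ z\in\{a,b,\$\}^*,\ \text{no } x_i \text{ is a proper prefix of an } x_j \text{ with } 1\le j<i,\ \text{and } y=x_m \text{ for some } m\,\},$$ $$\hat L_{mi}=\{\,x\,\text{¢}\,v\,\$\,v^R\,\#_2 \mid x\in\{a,b,\$\}^*,\ v\in\{a,b\}^*\,\},$$ where $v^R$ is the reversal of $v$. With three new symbols $\bullet_1,\bullet_2,\bullet$ let $L=\bullet_1\hat L_p\cup\bullet_2\hat L_{mi}$, and let $h$ be the length-preserving homomorphism that maps $\bullet_1$ and $\bullet_2$ to $\bullet$ and every other symbol to itself. **Proposition.** Neither $\mathscr{L}_{rt}(\mathrm{TWSDA})$ nor $\mathscr{L}_{rt}(\mathrm{TWSDNEA})$ is closed under length-preserving homomorphisms, i.e. homomorphisms $g\colon\Sigma^*\to\Delta^*$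 with $|g(w)|=|w|$ for all $w\in\Sigma^*$. More precisely, $L$ belongs to $\mathscr{L}_{rt}(\mathrm{TWSDNEA})$ and to $\mathscr{L}_{rt}(\mathrm{TWSDA})$, whereas $h(L)$ belongs to neither of the two families. -/

import Mathlib

/-! Deterministic tree-walking-storage automata. -/

/-- Left or right descendant. -/
inductive Side : Type where
  | l
  | r
deriving DecidableEq

/-- A potential node of a binary tree, i.e. a word over `{l, r}`. The word is stored with its last
letter first, so that the root is `[]`, the descendants of `P` are `Side.l :: P` and `Side.r :: P`,
and the ancestor of a non-root node is its tail. -/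
abbrev Node : Type := List Side

/-- A partial labelling of the nodes: `T P = none` means that `P` is not a node of the tree,
`T P = some none` that `P` carries the root symbol `⊥`, and `T P = some (some x)` that `P` carries
the tree symbol `x`. -/
abbrev Labelling (Γ : Type) : Type := Node → Option (Option Γ)

/-- `Γ`-trees: the domain is finite, non-empty and closed under passing to ancestors, and exactly
the root is labelled by `⊥`. -/
structure IsGammaTree {Γ : Type} (T : Labelling Γ) : Prop where
  finite : {P | (T P).isSome}.Finite
  root : T [] = some none
  closed : ∀ d P, (T (d :: P)).isSome → (T P).isSome
  bot_only_root : ∀ P, T P = some none → P = []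

/-- The type of a node: what the node is (`none` for the root, otherwise a left or right
descendant), and whether it has a left and a right descendant. -/
structure NodeType : Type where
  pos : Option Side
  hasLeft : Bool
  hasRight : Bool

/-- Whether a node of the given type has a descendant on side `d`. -/
def NodeType.has (t : NodeType) : Side → Bool
  | Side.l => t.hasLeft
  | Side.r => t.hasRight

/-- The type of the node `P` in `T`. -/
def nodeType {Γ : Type} (T : Labelling Γ) (P : Node) : NodeType where
  pos := P.head?
  hasLeft := (T (Side.l :: P)).isSome
  hasRight := (T (Side.r :: P)).isSome

/-- The operations on the tree storage. -/
inductive StorageAction (Γ : Type) : Type where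
  | up
  | stay
  | down (d : Side)
  | pop
  | push (x : Γ) (d : Side)

/-- The operation is possible at a node of type `t`: the pointer is never moved to a non-existing
node, only non-root leaves are popped, and no existing descendant is pushed. -/
def StorageAction.Legal {Γ : Type} (t : NodeType) : StorageAction Γ → Prop
  | .up => t.pos ≠ none
  | .stay => True
  | .down d => t.has d = true
  | .pop => t.pos ≠ none ∧ t.hasLeft = false ∧ t.hasRight = false
  | .push _ d => t.has d = false

/-- The effect of an operation on the tree and on the tree pointer. -/
def StorageAction.apply {Γ : Type} (T : Labelling Γ) (P : Node) : StorageAction Γ → Labelling Γ × Node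
  | .up => (T, P.tail)
  | .stay => (T, P)
  | .down d => (T, d :: P)
  | .pop => (Function.update T P none, P.tail)
  | .push x d => (Function.update T (d :: P) (some (some x)), d :: P)

/-- Input symbols together with the endmarker. -/
inductive InputSymbol (α : Type) : Type where
  | letter (a : α)
  | endmarker

/-- A deterministic tree-walking-storage automaton with input alphabet `α`, states `Q` and tree
symbols `Γ`. In the second argument of the partial transition function, `none` stands for the empty
word; in the fourth argument, `none` stands for the root symbol `⊥`. -/
structure TWSDA (α Q Γ : Type) : Type where
  start : Q
  accept : Set Q
  δ : Q → Option (InputSymbol α) → NodeType → Option Γ → Option (Q × StorageAction Γ)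
  no_choice : ∀ q t x, δ q none t x ≠ none → ∀ s : InputSymbol α, δ q (some s) t x = none
  legal : ∀ q i t x q' act, δ q i t x = some (q', act) → act.Legal t

/-- State, unread part of the input, current tree, tree pointer. -/
structure TWSDA.Config (α Q Γ : Type) : Type where
  state : Q
  unread : List (InputSymbol α)
  tree : Labelling Γ
  pointer : Node

namespace TWSDA

variable {α Q Γ : Type}

/-- The initial configuration for the input `w`: the tree consists of the root only. -/
def init (M : TWSDA α Q Γ) (w : List α) : Config α Q Γ where
  state := M.start
  unread := w.map InputSymbol.letter ++ [InputSymbol.endmarker]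
  tree := fun P => if P = [] then some none else none
  pointer := []

/-- `M.Applicable c i q' act`: in configuration `c` the transition function is defined for the
input `i` (the empty word or the first unread symbol), with value `(q', act)`. -/
def Applicable (M : TWSDA α Q Γ) (c : Config α Q Γ) (i : Option (InputSymbol α))
    (q' : Q) (act : StorageAction Γ) : Prop :=
  (∀ s, i = some s → c.unread.head? = some s) ∧
  ∃ x, c.tree c.pointer = some x ∧
    M.δ c.state i (nodeType c.tree c.pointer) x = some (q', act)

/-- The successor relation on configurations. -/
def Step (M : TWSDA α Q Γ) (c c' : Config α Q Γ) : Prop :=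
  ∃ i q' act, M.Applicable c i q' act ∧
    c.unread = i.toList ++ c'.unread ∧
    c'.state = q' ∧
    (c'.tree, c'.pointer) = act.apply c.tree c.pointer

/-- `c'` is reachable from `c` in finitely many steps. -/
def Reaches (M : TWSDA α Q Γ) (c c' : Config α Q Γ) : Prop :=
  Relation.ReflTransGen M.Step c c'

/-- The transition function is not defined for the configuration. -/
def Halted (M : TWSDA α Q Γ) (c : Config α Q Γ) : Prop :=
  ¬ ∃ i q' act, M.Applicable c i q' act

/-- The language accepted by `M`: the words on which `M` halts in an accepting state after having
read the input and the endmarker entirely. -/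
def accepted (M : TWSDA α Q Γ) : Language α :=
  {w | ∃ c, M.Reaches (M.init w) c ∧ M.Halted c ∧ c.unread = [] ∧ c.state ∈ M.accept}

/-- `M` works in real time: the transition function is undefined for empty input. -/
def RealTime (M : TWSDA α Q Γ) : Prop :=
  ∀ q t x, M.δ q none t x = none

/-- `M` never pops. -/
def NonErasing (M : TWSDA α Q Γ) : Prop :=
  ∀ q i t x q', M.δ q i t x ≠ some (q', StorageAction.pop)

/-- In every reachable configuration the storage is a `Γ`-tree and the pointer is one of its
nodes. -/
theorem isGammaTree_of_reaches (M : TWSDA α Q Γ) (w : List α) (c : Config α Q Γ)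
    (h : M.Reaches (M.init w) c) : IsGammaTree c.tree ∧ (c.tree c.pointer).isSome := by
  induction h with
  | refl =>
    refine ⟨⟨?_, by simp [init], ?_, ?_⟩, by simp [init]⟩
    · refine (Set.finite_singleton ([] : Node)).subset ?_
      intro P hP
      by_contra hne
      simp_all [init]
    · intro d P hP
      simp [init] at hP
    · intro P hP
      by_contra hne
      simp [init, hne] at hP
  | @tail c c' _ hs ih =>
    obtain ⟨i, q', act, ⟨-, x, hx, hδ⟩, -, -, hact⟩ := hs
    obtain ⟨hT, hP⟩ := ih
    have hl := M.legal _ _ _ _ _ _ hδ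
    cases act with
    | up =>
      simp only [StorageAction.apply, Prod.mk.injEq] at hact
      rw [hact.1, hact.2]
      refine ⟨hT, ?_⟩
      cases hp : c.pointer with
      | nil => simp [hT.root]
      | cons d P => rw [hp] at hP; exact hT.closed d P hP
    | stay =>
      simp only [StorageAction.apply, Prod.mk.injEq] at hact
      rw [hact.1, hact.2]
      exact ⟨hT, hP⟩
    | down d =>
      simp only [StorageAction.apply, Prod.mk.injEq] at hact
      rw [hact.1, hact.2]
      refine ⟨hT, ?_⟩
      cases d <;> simpa [StorageAction.Legal, NodeType.has, nodeType] using hl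
    | pop =>
      simp only [StorageAction.apply, Prod.mk.injEq] at hact
      rw [hact.1, hact.2]
      cases hp : c.pointer with
      | nil => simp [StorageAction.Legal, nodeType, hp] at hl
      | cons d P =>
        rw [hp] at hP hl
        have hne : P ≠ d :: P := by
          intro h
          simpa using congrArg List.length h
        refine ⟨⟨?_, ?_, ?_, ?_⟩, ?_⟩
        · refine hT.finite.subset ?_
          intro R hR
          by_cases hRe : R = d :: P
          · simp [hRe] at hR
          · simpa [Function.update_of_ne hRe] using hR
        · rw [Function.update_of_ne (by simp)]
          exact hT.root
        · intro e R hR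
          by_cases hRe : e :: R = d :: P
          · rw [hRe] at hR
            simp at hR
          · rw [Function.update_of_ne hRe] at hR
            have hRR : R ≠ d :: P := by
              rintro rfl
              simp only [StorageAction.Legal, nodeType] at hl
              cases e
              · simp [hl.2.1] at hR
              · simp [hl.2.2] at hR
            rw [Function.update_of_ne hRR]
            exact hT.closed e R hR
        · intro R hR
          by_cases hRe : R = d :: P
          · simp [hRe] at hR
          · rw [Function.update_of_ne hRe] at hR
            exact hT.bot_only_root R hR
        · rw [List.tail_cons, Function.update_of_ne hne]
          exact hT.closed d P hP
    | push y d =>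
      simp only [StorageAction.apply, Prod.mk.injEq] at hact
      rw [hact.1, hact.2]
      refine ⟨⟨?_, ?_, ?_, ?_⟩, by simp⟩
      · refine (hT.finite.insert (d :: c.pointer)).subset ?_
        intro R hR
        by_cases hRe : R = d :: c.pointer
        · exact Or.inl hRe
        · right
          simpa [Function.update_of_ne hRe] using hR
      · rw [Function.update_of_ne (by simp)]
        exact hT.root
      · intro e R hR
        by_cases hRR : R = d :: c.pointer
        · simp [hRR]
        · rw [Function.update_of_ne hRR]
          by_cases hRe : e :: R = d :: c.pointer
          · have : R = c.pointer := by simpa using congrArg List.tail hRe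
            rw [this]
            exact hP
          · rw [Function.update_of_ne hRe] at hR
            exact hT.closed e R hR
      · intro R hR
        by_cases hRe : R = d :: c.pointer
        · simp [hRe] at hR
        · rw [Function.update_of_ne hRe] at hR
          exact hT.bot_only_root R hR

end TWSDA

/-- A family of languages, given by the languages over each alphabet. -/
abbrev LanguageFamily : Type 1 := (α : Type) → Set (Language α)

/-- The languages accepted by deterministic tree-walking-storage automata in real time. -/
def rtTWSDA : LanguageFamily := fun α =>
  {L | ∃ (Q Γ : Type) (_ : Finite Q) (_ : Finite Γ) (M : TWSDA α Q Γ),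
    M.RealTime ∧ M.accepted = L}

/-- The languages accepted by non-erasing deterministic tree-walking-storage automata in real
time. -/
def rtTWSDNEA : LanguageFamily := fun α =>
  {L | ∃ (Q Γ : Type) (_ : Finite Q) (_ : Finite Γ) (M : TWSDA α Q Γ),
    M.NonErasing ∧ M.RealTime ∧ M.accepted = L}

/-- The homomorphism `h` of free monoids preserves the length of words. -/
def LengthPreserving {α β : Type} (h : FreeMonoid α →* FreeMonoid β) : Prop :=
  ∀ w, (h w).length = w.length

/-- The image of a language under a homomorphism. -/
def homImage {α β : Type} (h : FreeMonoid α →* FreeMonoid β) (L : Language α) : Language β :=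
  {v | ∃ w ∈ L, FreeMonoid.toList (h (FreeMonoid.ofList w)) = v}

/-- The family is closed under length-preserving homomorphisms between finitely generated free
monoids. -/
def ClosedUnderLengthPreservingHom (F : LanguageFamily) : Prop :=
  ∀ (α β : Type) [Finite α] [Finite β] (h : FreeMonoid α →* FreeMonoid β), LengthPreserving h →
    ∀ L ∈ F α, homImage h L ∈ F β

/-- The alphabet `{a, b, $, ¢, #₁, #₂}`. -/
inductive BaseSymbol : Type where
  | a
  | b
  | dollar
  | cent
  | border1
  | border2

/-- The alphabet `{a, b, $, ¢, #₁, #₂, •₁, •₂}`. -/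
inductive HintedSymbol : Type where
  | sym (s : BaseSymbol)
  | hint1
  | hint2

/-- The alphabet `{a, b, $, ¢, #₁, #₂, •}`. -/
inductive MergedSymbol : Type where
  | sym (s : BaseSymbol)
  | hint

/-- Words over `{a, b}`. -/
def IsWordAB (x : List BaseSymbol) : Prop :=
  ∀ s ∈ x, s = BaseSymbol.a ∨ s = BaseSymbol.b

/-- Words over `{a, b, $}`. -/
def IsWordABDollar (x : List BaseSymbol) : Prop :=
  ∀ s ∈ x, s = BaseSymbol.a ∨ s = BaseSymbol.b ∨ s = BaseSymbol.dollar

/-- The words `x₁ $^|x₁| ⋯ x_k $^|x_k| ¢ z #₁ y` such that the `x_i` are words over `{a, b}`, `z` is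
a word over `{a, b, $}`, no `x_i` is a proper prefix of an `x_j` with `j < i`, and `y` is one of the
`x_i`. -/
def hatLp : Language BaseSymbol :=
  {w | ∃ (xs : List (List BaseSymbol)) (z y : List BaseSymbol),
    (∀ x ∈ xs, IsWordAB x) ∧ IsWordABDollar z ∧
    xs.Pairwise (fun xj xi => ¬ (xi <+: xj ∧ xi ≠ xj)) ∧
    y ∈ xs ∧
    w = xs.flatMap (fun x => x ++ List.replicate x.length BaseSymbol.dollar) ++
      [BaseSymbol.cent] ++ z ++ [BaseSymbol.border1] ++ y}

/-- The words `x ¢ v $ v^R #₂` with `x` over `{a, b, $}` and `v` over `{a, b}`. -/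
def hatLmi : Language BaseSymbol :=
  {w | ∃ x v : List BaseSymbol, IsWordABDollar x ∧ IsWordAB v ∧
    w = x ++ [BaseSymbol.cent] ++ v ++ [BaseSymbol.dollar] ++ v.reverse ++ [BaseSymbol.border2]}

/-- The language `•₁ L̂_p ∪ •₂ L̂_mi`. -/
def hintedLanguage : Language HintedSymbol :=
  {w | (∃ u ∈ hatLp, w = HintedSymbol.hint1 :: u.map HintedSymbol.sym) ∨
    (∃ u ∈ hatLmi, w = HintedSymbol.hint2 :: u.map HintedSymbol.sym)}

/-- Replaces both hint symbols by the single hint symbol and keeps all other symbols. -/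
def mergeSymbol : HintedSymbol → MergedSymbol
  | .sym s => .sym s
  | .hint1 => .hint
  | .hint2 => .hint

/-- The homomorphism that merges the two hint symbols. -/
def mergeHints : FreeMonoid HintedSymbol →* FreeMonoid MergedSymbol :=
  FreeMonoid.map mergeSymbol

/-! With hints, the automaton knows which task to prepare for. After •₁ it stores the words x_i in a
trie: it descends along x_i, and the block of $ gives it the time to return to the root. A label
cannot be changed later, so the mark for the end of a word must be written when the node is pushed.
Storing therefore lags one letter behind, and the last letter is stored on the first $. If that node
already exists, it is already marked unless x_i is a proper prefix of an earlier word. This is the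
situation that L̂_p forbids, and it shows in the node not being a leaf. After •₂ the tree serves as
a pushdown store: v is written as a path, and the way back up compares letters with sides of nodes,
without popping.

Once the hints are merged, both tasks must be prepared at once. Let X be a set of words of length l,
stored as a dictionary and followed by ¢v. The query #₁y with the endmarker takes l + 2 steps, so in
real time its answer depends only on the state and on the tree within distance l + 2 of the pointer
(`AcceptsFrom.of_locallyEq`). There are 2^(2^l) sets X, but too few views with at most s nodes,
where s is 2^l up to a constant factor (`card_le_of_locallyEq`). Hence for some X at least s nodes
lie near the pointer, whatever v is.

For this X, distinct v lead to distinct configurations, because v can be checked by $v^R#₂. So words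
v of length at most n drive the pointer to many nodes (`le_card_of_distinct`), among which m are
pairwise more than 2h apart (`exists_separated_subset`). Balls around distant nodes of a binary tree
overlap little (`card_nodeBall_inter_le`), so together these m neighbourhoods contain nearly m·s
nodes. Yet the dictionary supplies only about 2l·2^l nodes and each v at most n more. With m a large
constant times l this is a contradiction (`exists_lower_bound_parameters`,
`TWSDA.false_of_dictionary`). -/

instance : Finite Side :=
  Finite.of_injective (fun d : Side => decide (d = Side.l)) (by
    intro a b; cases a <;> cases b <;> simp)

/-! ### Real-time computations as iterated partial maps -/

/-- A configuration without its unread input. -/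
structure Snap (Q Γ : Type) : Type where
  state : Q
  tree : Labelling Γ
  pointer : Node

/-- The configuration with the given unread input. -/
def Snap.withInput {α Q Γ : Type} (c : Snap Q Γ) (w : List (InputSymbol α)) :
    TWSDA.Config α Q Γ :=
  ⟨c.state, w, c.tree, c.pointer⟩

/-- A word followed by the endmarker. -/
def withEnd {α : Type} (w : List α) : List (InputSymbol α) :=
  w.map InputSymbol.letter ++ [InputSymbol.endmarker]

namespace TWSDA

variable {α Q Γ : Type}

/-- The initial configuration without its input. -/
def initSnap (M : TWSDA α Q Γ) : Snap Q Γ where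
  state := M.start
  tree := fun P => if P = [] then some none else none
  pointer := []

/-- The effect of reading one input symbol. -/
def next (M : TWSDA α Q Γ) (c : Snap Q Γ) (s : InputSymbol α) : Option (Snap Q Γ) :=
  (c.tree c.pointer).bind fun x =>
    (M.δ c.state (some s) (nodeType c.tree c.pointer) x).map fun p =>
      ⟨p.1, (p.2.apply c.tree c.pointer).1, (p.2.apply c.tree c.pointer).2⟩

/-- The effect of reading a word in real time. -/
def run (M : TWSDA α Q Γ) : Snap Q Γ → List (InputSymbol α) → Option (Snap Q Γ)
  | c, [] => some c
  | c, s :: w => (M.next c s).bind fun c' => M.run c' w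

/-- The real-time computation on `w` starting at `c` ends in an accepting state. -/
def AcceptsFrom (M : TWSDA α Q Γ) (c : Snap Q Γ) (w : List (InputSymbol α)) : Prop :=
  ∃ c', M.run c w = some c' ∧ c'.state ∈ M.accept

theorem next_eq_some (M : TWSDA α Q Γ) {c c' : Snap Q Γ} {s : InputSymbol α} :
    M.next c s = some c' ↔ ∃ x act, c.tree c.pointer = some x ∧
      M.δ c.state (some s) (nodeType c.tree c.pointer) x = some (c'.state, act) ∧
      (c'.tree, c'.pointer) = act.apply c.tree c.pointer := by
  unfold next
  simp only [Option.bind_eq_some_iff, Option.map_eq_some_iff]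
  constructor
  · rintro ⟨x, hx, ⟨q, act⟩, hδ, rfl⟩
    exact ⟨x, act, hx, hδ, rfl⟩
  · rintro ⟨x, act, hx, hδ, h⟩
    refine ⟨x, hx, (c'.state, act), hδ, ?_⟩
    rw [← h]

theorem run_append (M : TWSDA α Q Γ) (c : Snap Q Γ) (u w : List (InputSymbol α)) :
    M.run c (u ++ w) = (M.run c u).bind fun c' => M.run c' w := by
  induction u generalizing c with
  | nil => rfl
  | cons s u ih =>
    simp only [List.cons_append, run]
    cases M.next c s with
    | none => rfl
    | some d => simpa using ih d

theorem acceptsFrom_append (M : TWSDA α Q Γ) {c : Snap Q Γ} {u w : List (InputSymbol α)} :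
    M.AcceptsFrom c (u ++ w) ↔ ∃ c', M.run c u = some c' ∧ M.AcceptsFrom c' w := by
  unfold AcceptsFrom
  rw [run_append]
  cases M.run c u <;> simp

theorem acceptsFrom_cons (M : TWSDA α Q Γ) {c : Snap Q Γ} {s : InputSymbol α}
    {w : List (InputSymbol α)} :
    M.AcceptsFrom c (s :: w) ↔ ∃ c', M.next c s = some c' ∧ M.AcceptsFrom c' w := by
  unfold AcceptsFrom
  rw [run]
  cases M.next c s <;> simp

theorem reaches_of_run (M : TWSDA α Q Γ) {c c' : Snap Q Γ} {u : List (InputSymbol α)}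
    (h : M.run c u = some c') (w : List (InputSymbol α)) :
    M.Reaches (c.withInput (u ++ w)) (c'.withInput w) := by
  induction u generalizing c with
  | nil =>
    obtain rfl : c = c' := by simpa [run] using h
    exact Relation.ReflTransGen.refl
  | cons s u ih =>
    simp only [run, Option.bind_eq_some_iff] at h
    obtain ⟨d, hd, h⟩ := h
    refine Relation.ReflTransGen.head ?_ (ih h)
    obtain ⟨x, act, hx, hδ, hact⟩ := M.next_eq_some.1 hd
    refine ⟨some s, d.state, act, ⟨?_, x, hx, hδ⟩, ?_, rfl, hact⟩
    · intro s' hs'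
      simpa [Snap.withInput] using hs'
    · simp [Snap.withInput]

theorem run_of_reaches (M : TWSDA α Q Γ) (hM : M.RealTime) {c c' : Config α Q Γ}
    (h : M.Reaches c c') :
    ∃ u, c.unread = u ++ c'.unread ∧
      M.run ⟨c.state, c.tree, c.pointer⟩ u = some ⟨c'.state, c'.tree, c'.pointer⟩ := by
  induction h using Relation.ReflTransGen.head_induction_on with
  | refl => exact ⟨[], rfl, rfl⟩
  | @head c d hs _ ih =>
    obtain ⟨u, hu, hrun⟩ := ih
    obtain ⟨i, q', act, ⟨-, x, hx, hδ⟩, hun, hq, hact⟩ := hs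
    cases i with
    | none => rw [hM] at hδ; cases hδ
    | some s =>
      refine ⟨s :: u, by rw [hun, hu]; rfl, ?_⟩
      rw [run, Option.bind_eq_some_iff]
      refine ⟨_, ?_, hrun⟩
      rw [M.next_eq_some]
      exact ⟨x, act, hx, by rw [hδ, hq], hact⟩

/-- Without λ-transitions the automaton halts as soon as the input is exhausted, so the halting
condition is automatic and each run consumes exactly one symbol per step. -/
theorem mem_accepted_iff (M : TWSDA α Q Γ) (hM : M.RealTime) (w : List α) :
    w ∈ M.accepted ↔ M.AcceptsFrom M.initSnap (withEnd w) := by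
  constructor
  · rintro ⟨c, hc, -, hun, hacc⟩
    obtain ⟨u, hu, hrun⟩ := M.run_of_reaches hM hc
    rw [hun, List.append_nil] at hu
    refine ⟨⟨c.state, c.tree, c.pointer⟩, ?_, hacc⟩
    rw [← hrun, ← hu]
    rfl
  · rintro ⟨c, hc, hacc⟩
    have h := M.reaches_of_run hc []
    rw [List.append_nil] at h
    refine ⟨_, h, ?_, rfl, hacc⟩
    rintro ⟨i, q', act, hi, x, -, hδ⟩
    cases i with
    | none => rw [hM] at hδ; cases hδ
    | some s => simpa [Snap.withInput] using hi s rfl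

theorem isGammaTree_of_run (M : TWSDA α Q Γ) {w : List α} {c : Snap Q Γ}
    (h : M.run M.initSnap (w.map InputSymbol.letter) = some c) :
    IsGammaTree c.tree ∧ (c.tree c.pointer).isSome :=
  M.isGammaTree_of_reaches w _ (M.reaches_of_run h [InputSymbol.endmarker])

/-- A step changes the tree only at the old and at the new pointer. -/
theorem tree_eq_of_next (M : TWSDA α Q Γ) {c c' : Snap Q Γ} {s : InputSymbol α}
    (h : M.next c s = some c') {P : Node} (hP : P ≠ c.pointer) (hP' : P ≠ c'.pointer) :
    c'.tree P = c.tree P := by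
  obtain ⟨x, act, -, -, hact⟩ := M.next_eq_some.1 h
  cases act <;> simp only [StorageAction.apply, Prod.mk.injEq] at hact <;>
    obtain ⟨h1, h2⟩ := hact <;> rw [h1]
  · rw [Function.update_of_ne hP]
  · rw [Function.update_of_ne (by rwa [← h2])]

/-- A step adds at most the new pointer to the nodes of the tree. -/
theorem isSome_of_next (M : TWSDA α Q Γ) {c c' : Snap Q Γ} {s : InputSymbol α}
    (h : M.next c s = some c') {P : Node} (hP : (c'.tree P).isSome) :
    (c.tree P).isSome ∨ P = c'.pointer := by
  obtain ⟨x, act, -, -, hact⟩ := M.next_eq_some.1 h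
  cases act <;> simp only [StorageAction.apply, Prod.mk.injEq] at hact <;>
    obtain ⟨h1, h2⟩ := hact <;> rw [h1] at hP
  · exact Or.inl hP
  · exact Or.inl hP
  · exact Or.inl hP
  · left
    rcases eq_or_ne P c.pointer with rfl | hne
    · simp at hP
    · rwa [Function.update_of_ne hne] at hP
  · rcases eq_or_ne P c'.pointer with rfl | hne
    · exact Or.inr rfl
    · rw [h2] at hne
      left; rwa [Function.update_of_ne hne] at hP

/-- In a run the number of nodes grows by at most the number of steps. -/
theorem exists_finset_of_run (M : TWSDA α Q Γ) {c c' : Snap Q Γ} {w : List (InputSymbol α)}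
    (h : M.run c w = some c') :
    ∃ F : Finset Node, F.card ≤ w.length ∧
      ∀ P, (c'.tree P).isSome → (c.tree P).isSome ∨ P ∈ F := by
  classical
  induction w generalizing c with
  | nil =>
    obtain rfl : c = c' := by simpa [run] using h
    exact ⟨∅, by simp, fun P hP => Or.inl hP⟩
  | cons s w ih =>
    simp only [run, Option.bind_eq_some_iff] at h
    obtain ⟨d, hd, h⟩ := h
    obtain ⟨F, hF, hFP⟩ := ih h
    refine ⟨insert d.pointer F, ?_, ?_⟩
    · exact (Finset.card_insert_le _ _).trans (by simpa using hF)
    · intro P hP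
      rcases hFP P hP with hP | hP
      · rcases M.isSome_of_next hd hP with hP | hP
        · exact Or.inl hP
        · exact Or.inr (by simp [hP])
      · exact Or.inr (by simp [hP])

end TWSDA

/-! ### Balls in the infinite binary tree -/

/-- All nodes of depth at most `n`. -/
def shallowNodes : ℕ → Finset Node
  | 0 => {[]}
  | n + 1 => insert [] ((shallowNodes n).image (List.cons Side.l) ∪
      (shallowNodes n).image (List.cons Side.r))

theorem mem_shallowNodes {n : ℕ} {w : Node} : w ∈ shallowNodes n ↔ w.length ≤ n := by
  induction n generalizing w with
  | zero => simp [shallowNodes]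
  | succ n ih =>
    cases w with
    | nil => simp [shallowNodes]
    | cons d w => cases d <;> simp [shallowNodes, ih]

theorem card_shallowNodes_lt (n : ℕ) : (shallowNodes n).card < 2 ^ (n + 1) := by
  induction n with
  | zero => simp [shallowNodes]
  | succ n ih =>
    have h1 := Finset.card_insert_le ([] : Node) ((shallowNodes n).image (List.cons Side.l) ∪
      (shallowNodes n).image (List.cons Side.r))
    have h2 := Finset.card_union_le ((shallowNodes n).image (List.cons Side.l))
      ((shallowNodes n).image (List.cons Side.r))
    have h3 : ((shallowNodes n).image (List.cons Side.l)).card ≤ _ := Finset.card_image_le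
    have h4 : ((shallowNodes n).image (List.cons Side.r)).card ≤ _ := Finset.card_image_le
    rw [shallowNodes, pow_succ]
    omega

/-- The nodes at distance at most `r` from `P`. -/
def nodeBall : Node → ℕ → Finset Node
  | P, 0 => {P}
  | P, r + 1 => (shallowNodes (r + 1)).image (· ++ P) ∪ nodeBall P.tail r

theorem mem_nodeBall {P : Node} {r : ℕ} {u : Node} :
    u ∈ nodeBall P r ↔ ∃ k w, u = w ++ P.drop k ∧ k + w.length ≤ r := by
  induction r generalizing P with
  | zero =>
    simp only [nodeBall, Finset.mem_singleton]
    constructor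
    · rintro rfl
      exact ⟨0, [], by simp, by simp⟩
    · rintro ⟨k, w, rfl, h⟩
      obtain rfl : k = 0 := by omega
      obtain rfl : w = [] := List.length_eq_zero_iff.1 (by omega)
      simp
  | succ r ih =>
    simp only [nodeBall, Finset.mem_union, Finset.mem_image, mem_shallowNodes, ih]
    constructor
    · rintro (⟨w, hw, rfl⟩ | ⟨k, w, rfl, h⟩)
      · exact ⟨0, w, by simp, by omega⟩
      · exact ⟨k + 1, w, by rw [← List.drop_one, List.drop_drop, Nat.add_comm], by omega⟩
    · rintro ⟨k, w, rfl, h⟩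
      cases k with
      | zero => exact Or.inl ⟨w, by omega, by simp⟩
      | succ k =>
        exact Or.inr ⟨k, w, by rw [← List.drop_one, List.drop_drop, Nat.add_comm], by omega⟩

theorem card_nodeBall_le (P : Node) (r : ℕ) : (nodeBall P r).card ≤ 2 ^ (r + 2) := by
  induction r generalizing P with
  | zero => simp [nodeBall]
  | succ r ih =>
    have h1 := Finset.card_union_le ((shallowNodes (r + 1)).image (· ++ P)) (nodeBall P.tail r)
    have h2 : ((shallowNodes (r + 1)).image (· ++ P)).card ≤ _ := Finset.card_image_le
    have h3 := card_shallowNodes_lt (r + 1)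
    have h4 := ih P.tail
    have h5 : 2 ^ (r + 1 + 2) = 2 ^ (r + 2) + 2 ^ (r + 2) := by ring
    rw [nodeBall, h5]
    have h6 : r + 1 + 1 = r + 2 := rfl
    rw [h6] at h3
    omega

theorem self_mem_nodeBall (P : Node) (r : ℕ) : P ∈ nodeBall P r :=
  mem_nodeBall.2 ⟨0, [], by simp, by simp⟩

theorem nodeBall_tail_subset (P : Node) (r : ℕ) : nodeBall P.tail r ⊆ nodeBall P (r + 1) :=
  Finset.subset_union_right

theorem nodeBall_mono (P : Node) {r r' : ℕ} (h : r ≤ r') : nodeBall P r ⊆ nodeBall P r' := by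
  intro u hu
  obtain ⟨k, w, rfl, hk⟩ := mem_nodeBall.1 hu
  exact mem_nodeBall.2 ⟨k, w, rfl, by omega⟩

theorem nodeBall_cons_subset (d : Side) (P : Node) (r : ℕ) :
    nodeBall (d :: P) r ⊆ nodeBall P (r + 1) := by
  intro u hu
  obtain ⟨k, w, rfl, hk⟩ := mem_nodeBall.1 hu
  cases k with
  | zero => exact mem_nodeBall.2 ⟨0, w ++ [d], by simp, by simp; omega⟩
  | succ k => exact mem_nodeBall.2 ⟨k, w, by simp, by omega⟩

/-- Addresses are stored with the last step first, so suffixes are ancestors and `A` is the lowest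
common ancestor. -/
theorem exists_longest_common_suffix (P P' : Node) :
    ∃ p p' A : Node, P = p ++ A ∧ P' = p' ++ A ∧ ∀ x, x <:+ P → x <:+ P' → x <:+ A := by
  induction P with
  | nil => exact ⟨[], P', [], by simp, by simp, fun x hx _ => hx⟩
  | cons d P ih =>
    by_cases h : d :: P <:+ P'
    · obtain ⟨p', hp'⟩ := h
      exact ⟨[], p', d :: P, rfl, hp'.symm, fun x hx _ => hx⟩
    · obtain ⟨p, p', A, rfl, rfl, hA⟩ := ih
      refine ⟨d :: p, p', A, rfl, rfl, fun x hx hx' => ?_⟩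
      rcases List.suffix_cons_iff.1 hx with rfl | hx
      · exact absurd hx' h
      · exact hA x hx hx'

/-- The path between the two nodes has more than `2 * h` edges, and the `h`-th ancestor of the
deeper one lies on it, at distance at least `h` from both ends. A common node `u` is reached through
this ancestor from at least one of them, which uses up `h` of the radius. -/
theorem nodeBall_inter_subset_of_long {p p' A : Node} {h r : ℕ}
    (hA : ∀ x, x <:+ p ++ A → x <:+ p' ++ A → x <:+ A)
    (hp : p'.length ≤ p.length) (hh : 2 * h < p.length + p'.length) :
    nodeBall (p ++ A) r ∩ nodeBall (p' ++ A) r ⊆ nodeBall ((p ++ A).drop h) (r - h) := by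
  intro u hu
  rw [Finset.mem_inter] at hu
  obtain ⟨k, w, hu1, hk⟩ := mem_nodeBall.1 hu.1
  obtain ⟨k', w', hu2, hk'⟩ := mem_nodeBall.1 hu.2
  rcases le_or_gt h k with hhk | hhk
  · exact mem_nodeBall.2 ⟨k - h, w, by rw [hu1, List.drop_drop]; congr 2; omega, by omega⟩
  · have s1 : (p ++ A).drop k <:+ u := ⟨w, hu1.symm⟩
    have s2 : (p' ++ A).drop k' <:+ u := ⟨w', hu2.symm⟩
    -- Here `u` lies below `(p ++ A).drop k`, strictly below `A`, so the walk from the other node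
    -- must first climb to `A` or higher and then descends through the `h`-th ancestor.
    have key : (p' ++ A).drop k' <:+ A := by
      rcases List.suffix_or_suffix_of_suffix s1 s2 with hs | hs
      · have := (hA _ (List.drop_suffix _ _) (hs.trans (List.drop_suffix _ _))).length_le
        simp at this
        omega
      · exact hA _ (hs.trans (List.drop_suffix _ _)) (List.drop_suffix _ _)
    have hlen := key.length_le
    have hul := congrArg List.length hu2
    have hul1 := congrArg List.length hu1
    simp only [List.length_drop, List.length_append] at hlen hul hul1
    have hd : (p ++ A).drop k = ((p ++ A).drop k).take (h - k) ++ (p ++ A).drop h := by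
      conv_lhs => rw [← List.take_append_drop (h - k) ((p ++ A).drop k)]
      rw [List.drop_drop]
      congr 2
      omega
    refine mem_nodeBall.2 ⟨0, w ++ ((p ++ A).drop k).take (h - k), ?_, ?_⟩
    · rw [List.drop_zero, List.append_assoc, ← hd, hu1]
    · simp only [List.length_append, List.length_take, List.length_drop]
      omega

/-- Balls around distant nodes have a small intersection. -/
theorem card_nodeBall_inter_le {P P' : Node} {h : ℕ} (hP : P' ∉ nodeBall P (2 * h)) (r : ℕ) :
    (nodeBall P r ∩ nodeBall P' r).card ≤ 2 ^ (r - h + 2) := by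
  obtain ⟨p, p', A, rfl, rfl, hA⟩ := exists_longest_common_suffix P P'
  have hh : 2 * h < p.length + p'.length := by
    by_contra hlt
    exact hP (mem_nodeBall.2 ⟨p.length, p', by simp, by omega⟩)
  rcases le_total p'.length p.length with hp | hp
  · exact (Finset.card_le_card (nodeBall_inter_subset_of_long hA hp hh)).trans
      (card_nodeBall_le _ _)
  · rw [Finset.inter_comm]
    exact (Finset.card_le_card (nodeBall_inter_subset_of_long
      (fun x h1 h2 => hA x h2 h1) hp (by omega))).trans (card_nodeBall_le _ _)

/-! ### Locality of real-time computations -/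

/-- Configurations that agree, up to a translation of the tree, within distance `r` of the
pointer. -/
structure LocallyEq {Q Γ : Type} (r : ℕ) (c c' : Snap Q Γ) : Prop where
  state_eq : c.state = c'.state
  tree_eq : ∃ w R R', c.pointer = w ++ R ∧ c'.pointer = w ++ R' ∧
    ((R = [] ∧ R' = []) ∨ r < w.length) ∧
    ∀ u ∈ nodeBall w r, c.tree (u ++ R) = c'.tree (u ++ R')

theorem LocallyEq.symm {Q Γ : Type} {r : ℕ} {c c' : Snap Q Γ} (h : LocallyEq r c c') :
    LocallyEq r c' c := by
  obtain ⟨hq, w, R, R', hP, hP', hR, hT⟩ := h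
  exact ⟨hq.symm, w, R', R, hP', hP, hR.imp And.symm id, fun u hu => (hT u hu).symm⟩

namespace TWSDA

variable {α Q Γ : Type}

/-- A step inspects the current node and its children and moves by at most one edge, so agreement
survives with radius one less. Unless both remainders `R`, `R'` are empty, `w` is longer than the
radius and hence nonempty, so it shows which kind of descendant the pointer is. -/
theorem LocallyEq.next (M : TWSDA α Q Γ) {r : ℕ} {c c' : Snap Q Γ}
    (h : LocallyEq (r + 1) c c') {s : InputSymbol α} {d : Snap Q Γ} (hd : M.next c s = some d) :
    ∃ d', M.next c' s = some d' ∧ LocallyEq r d d' := by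
  obtain ⟨hq, w, R, R', hP, hP', hR, hT⟩ := h
  obtain ⟨x, act, hx, hδ, hact⟩ := M.next_eq_some.1 hd
  have hx' : c'.tree c'.pointer = some x := by
    rw [hP', ← hT w (self_mem_nodeBall _ _), ← hP, hx]
  have hchild : ∀ e, c.tree (e :: c.pointer) = c'.tree (e :: c'.pointer) := by
    intro e
    rw [hP, hP']
    exact hT (e :: w) (mem_nodeBall.2 ⟨0, [e], by simp, by simp⟩)
  have hpos : c.pointer.head? = c'.pointer.head? := by
    rw [hP, hP']
    rcases hR with ⟨rfl, rfl⟩ | hR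
    · rfl
    · cases w with
      | nil => simp at hR
      | cons e w => rfl
  have htype : nodeType c.tree c.pointer = nodeType c'.tree c'.pointer := by
    simp only [nodeType, hpos, hchild]
  rw [hq, htype] at hδ
  refine ⟨⟨d.state, (act.apply c'.tree c'.pointer).1, (act.apply c'.tree c'.pointer).2⟩,
    M.next_eq_some.2 ⟨x, act, hx', hδ, rfl⟩, rfl, ?_⟩
  have hT0 : ∀ u ∈ nodeBall w r, c.tree (u ++ R) = c'.tree (u ++ R') :=
    fun u hu => hT u (nodeBall_mono w (Nat.le_succ r) hu)
  have hTtail : ∀ u ∈ nodeBall w.tail r, c.tree (u ++ R) = c'.tree (u ++ R') :=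
    fun u hu => hT u (nodeBall_tail_subset w r hu)
  have hTcons : ∀ e, ∀ u ∈ nodeBall (e :: w) r, c.tree (u ++ R) = c'.tree (u ++ R') :=
    fun e u hu => hT u (nodeBall_cons_subset e w r hu)
  have htail : ∀ S, ((R = [] ∧ R' = []) → S = []) → (w ++ S).tail = w.tail ++ S := by
    intro S hS
    rcases hR with hR | hR
    · rw [hS hR]; simp
    · cases w with
      | nil => simp at hR
      | cons e w => rfl
  have hRtail : (R = [] ∧ R' = []) ∨ r < w.tail.length := by
    rcases hR with hR | hR
    · exact Or.inl hR
    · exact Or.inr (by rw [List.length_tail]; omega)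
  have hR0 : (R = [] ∧ R' = []) ∨ r < w.length := hR.imp id (fun h => by omega)
  cases act with
  | up =>
    simp only [StorageAction.apply, Prod.mk.injEq] at hact ⊢
    rw [hact.1, hact.2, hP, hP']
    exact ⟨w.tail, R, R', htail R (fun h => h.1), htail R' (fun h => h.2), hRtail, hTtail⟩
  | stay =>
    simp only [StorageAction.apply, Prod.mk.injEq] at hact ⊢
    rw [hact.1, hact.2]
    exact ⟨w, R, R', hP, hP', hR0, hT0⟩
  | down e =>
    simp only [StorageAction.apply, Prod.mk.injEq] at hact ⊢
    rw [hact.1, hact.2, hP, hP']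
    exact ⟨e :: w, R, R', rfl, rfl, hR.imp id (fun h => by simp; omega), hTcons e⟩
  | pop =>
    simp only [StorageAction.apply, Prod.mk.injEq] at hact ⊢
    rw [hact.1, hact.2, hP, hP']
    refine ⟨w.tail, R, R', htail R (fun h => h.1), htail R' (fun h => h.2), hRtail, ?_⟩
    intro u hu
    -- The equation `u ++ R = w ++ R` means `u = w`, and likewise for `R'`; thus both trees change
    -- at corresponding nodes.
    simp only [Function.update_apply, List.append_cancel_right_eq]
    split
    · rfl
    · exact hTtail u hu
  | push y e =>
    simp only [StorageAction.apply, Prod.mk.injEq] at hact ⊢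
    rw [hact.1, hact.2, hP, hP']
    refine ⟨e :: w, R, R', rfl, rfl, hR.imp id (fun h => by simp; omega), ?_⟩
    intro u hu
    simp only [Function.update_apply, ← List.cons_append, List.append_cancel_right_eq]
    split
    · rfl
    · exact hTcons e u hu

/-- The outcome of a short computation depends only on the tree near the pointer. -/
theorem AcceptsFrom.of_locallyEq (M : TWSDA α Q Γ) {w : List (InputSymbol α)} {c c' : Snap Q Γ}
    (hacc : M.AcceptsFrom c w) (h : LocallyEq w.length c c') : M.AcceptsFrom c' w := by
  induction w generalizing c c' with
  | nil =>
    obtain ⟨d, hd, hacc⟩ := hacc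
    obtain rfl : c = d := by simpa [run] using hd
    exact ⟨c', rfl, h.state_eq ▸ hacc⟩
  | cons s w ih =>
    obtain ⟨d, hd, hacc⟩ := M.acceptsFrom_cons.1 hacc
    obtain ⟨d', hd', hdd'⟩ := LocallyEq.next M h hd
    exact M.acceptsFrom_cons.2 ⟨d', hd', ih hacc hdd'⟩

end TWSDA

/-! ### Finite labelled trees and their preorder codes -/

/-- Finite binary trees with labels in `Λ`. -/
inductive LabelTree (Λ : Type) : Type where
  | leaf
  | node (x : Λ) (t₁ t₂ : LabelTree Λ)

namespace LabelTree

variable {Λ : Type}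

/-- The number of labelled nodes. -/
def size : LabelTree Λ → ℕ
  | leaf => 0
  | node _ t₁ t₂ => t₁.size + t₂.size + 1

/-- The label of a node, which is given by the path from the root. -/
def lookup : LabelTree Λ → List Side → Option Λ
  | leaf, _ => none
  | node x _ _, [] => some x
  | node _ t₁ _, Side.l :: u => t₁.lookup u
  | node _ _ t₂, Side.r :: u => t₂.lookup u

/-- The preorder listing of a tree. -/
def code : LabelTree Λ → List (Option Λ)
  | leaf => [none]
  | node x t₁ t₂ => some x :: (t₁.code ++ t₂.code)

theorem length_code (t : LabelTree Λ) : t.code.length = 2 * t.size + 1 := by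
  induction t with
  | leaf => rfl
  | node x t₁ t₂ h₁ h₂ => simp [code, size, h₁, h₂]; omega

/-- The preorder code is prefix-free; the trailing words are needed for the induction, where the
code of the left subtree is followed by that of the right one. -/
theorem code_append_inj {t t' : LabelTree Λ} {u u' : List (Option Λ)}
    (h : t.code ++ u = t'.code ++ u') : t = t' ∧ u = u' := by
  induction t generalizing t' u u' with
  | leaf =>
    cases t' with
    | leaf => simpa [code] using h
    | node x' t₁' t₂' => simp [code] at h
  | node x t₁ t₂ h₁ h₂ =>
    cases t' with
    | leaf => simp [code] at h
    | node x' t₁' t₂' =>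
      simp only [code, List.cons_append, List.append_assoc, List.cons.injEq,
        Option.some.injEq] at h
      obtain ⟨hx, h⟩ := h
      obtain ⟨e₁, h⟩ := h₁ h
      obtain ⟨e₂, h⟩ := h₂ h
      exact ⟨by rw [hx, e₁, e₂], h⟩

theorem code_injective : Function.Injective (code : LabelTree Λ → List (Option Λ)) := by
  intro t t' h
  exact (code_append_inj (u := []) (u' := []) (by simpa using h)).1

/-- A partial labelling of the nodes whose domain is finite and closed under ancestors comes from
a tree. -/
theorem exists_lookup_eq (σ : Node → Option Λ) (hσ : ∀ d P, (σ (d :: P)).isSome → (σ P).isSome)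
    (F : Finset Node) (hF : ∀ P, (σ P).isSome → P ∈ F) :
    ∃ t : LabelTree Λ, t.size ≤ F.card ∧ ∀ P, t.lookup P.reverse = σ P := by
  induction hn : F.card using Nat.strong_induction_on generalizing σ F with
  | _ n ih =>
  subst hn
  cases hroot : σ [] with
  | none =>
    refine ⟨leaf, Nat.zero_le _, fun P => ?_⟩
    have : ∀ P, σ P = none := by
      intro P
      induction P with
      | nil => exact hroot
      | cons d P hP =>
        by_contra hne
        have := hσ d P (Option.isSome_iff_ne_none.2 hne)
        simp [hP] at this
    rw [this P]
    rfl
  | some x =>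
    have hmem : ([] : Node) ∈ F := hF [] (by simp [hroot])
    -- The last letter of an address is the first direction taken from the root, so `G d` covers the
    -- nodes below the child `d`, and removing that letter in `H d` gives their addresses in the
    -- subtree.
    let G : Side → Finset Node := fun d => (F.erase []).filter fun P => P.getLast? = some d
    let H : Side → Finset Node := fun d => (G d).image List.dropLast
    have hG : (G Side.l).card + (G Side.r).card ≤ (F.erase []).card := by
      rw [← Finset.card_union_of_disjoint]
      · exact Finset.card_le_card
          (Finset.union_subset (Finset.filter_subset _ _) (Finset.filter_subset _ _))
      · rw [Finset.disjoint_left]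
        intro P h1 h2
        have e1 := (Finset.mem_filter.1 h1).2
        have e2 := (Finset.mem_filter.1 h2).2
        rw [e1] at e2
        cases e2
    have hFe : (F.erase []).card + 1 = F.card := Finset.card_erase_add_one hmem
    have hH : ∀ d, (H d).card ≤ (G d).card := fun d => Finset.card_image_le
    have hsub : ∀ d P, (σ (P ++ [d])).isSome → P ∈ H d := by
      intro d P hP
      refine Finset.mem_image.2 ⟨P ++ [d], ?_, by simp⟩
      simpa [G] using hF _ hP
    have hl := hH Side.l
    have hr := hH Side.r
    obtain ⟨t₁, hs₁, ht₁⟩ := ih (H Side.l).card (by omega) (fun P => σ (P ++ [Side.l]))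
      (fun d P hP => hσ d _ hP) (H Side.l) (hsub Side.l) rfl
    obtain ⟨t₂, hs₂, ht₂⟩ := ih (H Side.r).card (by omega) (fun P => σ (P ++ [Side.r]))
      (fun d P hP => hσ d _ hP) (H Side.r) (hsub Side.r) rfl
    refine ⟨node x t₁ t₂, by simp only [size]; omega, fun P => ?_⟩
    induction P using List.reverseRecOn with
    | nil => exact hroot.symm
    | append_singleton P d _ =>
      rw [List.reverse_append, List.reverse_singleton, List.singleton_append]
      cases d
      · exact ht₁ P
      · exact ht₂ P

end LabelTree

/-- Lists of bounded length are padded with `none` to functions on `Fin n`, which are easy to count.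
-/
theorem eq_of_getElem?_fin_eq {β : Type} {n : ℕ} {u v : List β} (hu : u.length ≤ n)
    (hv : v.length ≤ n) (h : (fun i : Fin n => u[(i : ℕ)]?) = fun i : Fin n => v[(i : ℕ)]?) :
    u = v := by
  apply List.ext_getElem?
  intro i
  by_cases hi : i < n
  · exact congrFun h ⟨i, hi⟩
  · rw [List.getElem?_eq_none (by omega), List.getElem?_eq_none (by omega)]

/-! ### Counting the views of few nodes -/

section

variable {Q Γ : Type}

/-- Up to translation the tree of `c` looks within distance `r` of the pointer like `t`, with the
pointer at `w`. -/
def HasView (r : ℕ) (c : Snap Q Γ) (t : LabelTree (Option Γ)) (w : Node) : Prop :=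
  ∃ R, c.pointer = w ++ R ∧ (R = [] ∨ r < w.length) ∧
    ∀ u ∈ nodeBall w r, c.tree (u ++ R) = t.lookup u.reverse

theorem HasView.locallyEq {r : ℕ} {c c' : Snap Q Γ} {t : LabelTree (Option Γ)} {w : Node}
    (h : HasView r c t w) (h' : HasView r c' t w) (hq : c.state = c'.state) :
    LocallyEq r c c' := by
  obtain ⟨R, hP, hR, hT⟩ := h
  obtain ⟨R', hP', hR', hT'⟩ := h'
  refine ⟨hq, w, R, R', hP, hP', ?_, fun u hu => by rw [hT u hu, hT' u hu]⟩
  tauto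

/-- The nodes of the tree at distance at most `r` from the pointer. -/
def Snap.near (c : Snap Q Γ) (r : ℕ) : Finset Node :=
  (nodeBall c.pointer r).filter fun u => (c.tree u).isSome

/-- Cutting the address of the pointer after `r + 1` steps upwards translates the visible part to
the root, which bounds the number of possible views independently of the depth. -/
theorem exists_hasView {r s : ℕ} {c : Snap Q Γ} (hc : IsGammaTree c.tree)
    (hs : (c.near r).card ≤ s) :
    ∃ t w, t.size ≤ s + 1 ∧ w.length ≤ r + 1 ∧ HasView r c t w := by
  classical
  obtain ⟨w, R, hw, hP, hR⟩ : ∃ w R : Node, w.length ≤ r + 1 ∧ c.pointer = w ++ R ∧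
      (R = [] ∨ w.length = r + 1) := by
    refine ⟨c.pointer.take (r + 1), c.pointer.drop (r + 1), by simp, by simp, ?_⟩
    rcases le_or_gt c.pointer.length (r + 1) with h | h
    · exact Or.inl (List.drop_eq_nil_of_le h)
    · exact Or.inr (by rw [List.length_take]; omega)
  have htrans : ∀ u ∈ nodeBall w r, u ++ R ∈ nodeBall c.pointer r := by
    intro u hu
    obtain ⟨k, v, rfl, hk⟩ := mem_nodeBall.1 hu
    refine mem_nodeBall.2 ⟨k, v, ?_, hk⟩
    rw [hP]
    rcases hR with rfl | hR
    · simp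
    · rw [List.drop_append_of_le_length (by omega), List.append_assoc]
  -- When `w` has length `r + 1`, the node `[]` lies outside the ball. It gets a dummy label to
  -- close the domain under ancestors; this is the `+ 1` in the size, and `HasView` never looks at
  -- it.
  let σ : Node → Option (Option Γ) := fun u =>
    if u ∈ nodeBall w r then c.tree (u ++ R) else if u = [] then some none else none
  let B := (nodeBall w r).filter fun u => (c.tree (u ++ R)).isSome
  have hB : B.card ≤ s := by
    refine le_trans ?_ hs
    apply Finset.card_le_card_of_injOn (· ++ R)
    · intro u hu
      have hu' := Finset.mem_filter.1 hu
      exact Finset.mem_coe.2 (Finset.mem_filter.2 ⟨htrans u hu'.1, hu'.2⟩)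
    · intro u _ v _ huv
      exact List.append_cancel_right huv
  obtain ⟨t, ht, hlook⟩ := LabelTree.exists_lookup_eq σ (by
    intro d P hdP
    have hb : d :: P ∈ nodeBall w r := by
      by_contra hb
      simp [σ, hb] at hdP
    have hdT : (c.tree (P ++ R)).isSome := by
      simp only [σ, hb, if_true] at hdP
      exact hc.closed d _ hdP
    by_cases hPb : P ∈ nodeBall w r
    · simpa only [σ, hPb, if_true] using hdT
    · have hPn : P = [] := by
        obtain ⟨k, v, hv, hk⟩ := mem_nodeBall.1 hb
        cases v with
        | cons e v =>
          simp only [List.cons_append, List.cons.injEq] at hv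
          exact absurd (mem_nodeBall.2 ⟨k, v, hv.2, by simp at hk; omega⟩) hPb
        | nil =>
          rw [List.nil_append] at hv
          have hPd : P = w.drop (k + 1) := by
            rw [← List.tail_drop, ← hv, List.tail_cons]
          rcases lt_or_ge k r with hkr | hkr
          · exact absurd (mem_nodeBall.2 ⟨k + 1, [], hPd, by simpa using hkr⟩) hPb
          · rw [hPd, List.drop_eq_nil_iff]; omega
      rw [hPn] at hPb
      simp [σ, hPb, hPn]) (insert [] B) (by
    intro P hP
    by_cases hPb : P ∈ nodeBall w r
    · simp only [σ, hPb, if_true] at hP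
      exact Finset.mem_insert_of_mem (Finset.mem_filter.2 ⟨hPb, hP⟩)
    · by_cases hPn : P = []
      · rw [hPn]
        exact Finset.mem_insert_self _ _
      · simp [σ, hPb, hPn] at hP)
  refine ⟨t, w, ht.trans ((Finset.card_insert_le _ _).trans (by omega)), hw, R, hP, ?_, ?_⟩
  · exact hR.imp id (fun h => by omega)
  · intro u hu
    rw [hlook u]
    simp only [σ, hu, if_true]

/-- Few configurations with few nodes near the pointer are pairwise distinguishable by short
computations. -/
theorem card_le_of_locallyEq {ι : Type} [Finite ι] [Finite Q] [Finite Γ] {r s : ℕ}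
    (c : ι → Snap Q Γ) (hc : ∀ i, IsGammaTree (c i).tree) (hs : ∀ i, ((c i).near r).card ≤ s)
    (hinj : ∀ i j, LocallyEq r (c i) (c j) → i = j) :
    Nat.card ι ≤ Nat.card Q * 3 ^ (r + 1) * (Nat.card Γ + 3) ^ (2 * s + 3) := by
  choose t w ht hw hview using fun i => exists_hasView (hc i) (hs i)
  -- An address has at most `r + 1` letters, each one of two sides or padding. A tree of size at
  -- most `s + 1` has a code of length at most `2 * s + 3`, over `Nat.card Γ + 2` symbols and
  -- padding.
  let f : ι → (Q × (Fin (r + 1) → Option Side)) ×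
      (Fin (2 * s + 3) → Option (Option (Option Γ))) := fun i =>
    (((c i).state, fun k => (w i)[(k : ℕ)]?), fun k => (t i).code[(k : ℕ)]?)
  have hf : Function.Injective f := by
    intro i j hij
    simp only [f, Prod.mk.injEq] at hij
    obtain ⟨⟨hq, hwij⟩, htij⟩ := hij
    have h1 : w i = w j := eq_of_getElem?_fin_eq (hw i) (hw j) hwij
    have h2 : t i = t j := LabelTree.code_injective (eq_of_getElem?_fin_eq
      (by rw [LabelTree.length_code]; have := ht i; omega)
      (by rw [LabelTree.length_code]; have := ht j; omega) htij)
    apply hinj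
    refine (hview i).locallyEq ?_ hq
    rw [h1, h2]
    exact hview j
  have hside : Nat.card Side = 2 := by
    rw [Nat.card_eq_two_iff]
    exact ⟨Side.l, Side.r, by simp, by ext d; cases d <;> simp⟩
  refine (Nat.card_le_card_of_injective f hf).trans (le_of_eq ?_)
  simp [Nat.card_prod, Nat.card_fun, Finite.card_option, hside]

end

/-! ### Packing, unions and a pigeonhole principle -/

/-- A large set of nodes contains many nodes that are pairwise far apart. -/
theorem exists_separated_subset (S : Finset Node) (h m : ℕ) (hS : m * 2 ^ (2 * h + 2) ≤ S.card) :
    ∃ A ⊆ S, A.card = m ∧ ∀ P ∈ A, ∀ P' ∈ A, P ≠ P' →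
      P' ∉ nodeBall P (2 * h) ∨ P ∉ nodeBall P' (2 * h) := by
  induction m with
  | zero => exact ⟨∅, by simp, by simp, by simp⟩
  | succ m ih =>
    obtain ⟨A, hAS, hA, hsep⟩ := ih (le_trans (Nat.mul_le_mul_right _ (Nat.le_succ m)) hS)
    have hcard : (A.biUnion fun P => nodeBall P (2 * h)).card < S.card := by
      have h1 : (A.biUnion fun P => nodeBall P (2 * h)).card ≤ A.card * 2 ^ (2 * h + 2) :=
        Finset.card_biUnion_le_card_mul _ _ _ fun P _ => card_nodeBall_le P _
      rw [hA] at h1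
      have h2 : 0 < 2 ^ (2 * h + 2) := by positivity
      rw [Nat.add_mul, one_mul] at hS
      omega
    -- Greedy choice: the balls around the nodes chosen so far do not exhaust `S`.
    obtain ⟨P, hPS, hP⟩ := Finset.exists_mem_notMem_of_card_lt_card hcard
    have hfar : ∀ P' ∈ A, P ∉ nodeBall P' (2 * h) := fun P' hP' hmem =>
      hP (Finset.mem_biUnion.2 ⟨P', hP', hmem⟩)
    have hPA : P ∉ A := fun hmem => hfar P hmem (self_mem_nodeBall _ _)
    refine ⟨insert P A, Finset.insert_subset hPS hAS, by rw [Finset.card_insert_of_notMem hPA, hA],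
      ?_⟩
    intro P₁ h₁ P₂ h₂ hne
    rcases Finset.mem_insert.1 h₁ with rfl | k₁ <;> rcases Finset.mem_insert.1 h₂ with rfl | k₂
    · exact absurd rfl hne
    · exact Or.inr (hfar _ k₂)
    · exact Or.inl (hfar _ k₁)
    · exact hsep _ k₁ _ k₂ hne

/-- Large sets with small pairwise intersections have a large union. -/
theorem card_mul_le_card_biUnion_add {ι β : Type} [DecidableEq ι] [DecidableEq β] (A : Finset ι)
    (B : ι → Finset β) (s b : ℕ) (hs : ∀ i ∈ A, s ≤ (B i).card)
    (hb : ∀ i ∈ A, ∀ j ∈ A, i ≠ j → (B i ∩ B j).card ≤ b) :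
    A.card * s ≤ (A.biUnion B).card + A.card * A.card * b := by
  induction A using Finset.induction_on with
  | empty => simp
  | insert i A hi ih =>
    have ih := ih (fun j hj => hs j (Finset.mem_insert_of_mem hj))
      (fun j hj k hk => hb j (Finset.mem_insert_of_mem hj) k (Finset.mem_insert_of_mem hk))
    have h1 := Finset.card_union_add_card_inter (B i) (A.biUnion B)
    have h2 : (B i ∩ A.biUnion B).card ≤ A.card * b := by
      rw [Finset.inter_biUnion]
      apply Finset.card_biUnion_le_card_mul
      intro j hj
      refine hb i (Finset.mem_insert_self _ _) j (Finset.mem_insert_of_mem hj) ?_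
      rintro rfl
      exact hi hj
    have h3 := hs i (Finset.mem_insert_self _ _)
    rw [Finset.card_insert_of_notMem hi, Finset.biUnion_insert]
    nlinarith

/-- An automaton that writes down different words by walking over few nodes ends up in the same
configuration for two of them. -/
theorem le_card_of_distinct {Q Γ : Type} [Finite Q] [Finite Γ] {C : List Side → Snap Q Γ}
    (hC : ∀ v d P, P ≠ (C v).pointer → P ≠ (C (v ++ [d])).pointer →
      (C (v ++ [d])).tree P = (C v).tree P)
    (hinj : Function.Injective C) {n m : ℕ} {S : Finset Node}
    (hS : ∀ v, v.length ≤ n → (C v).pointer ∈ S)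
    (hn : Nat.card Q * m * (Nat.card Γ + 2) ^ m < 2 ^ n) : m ≤ S.card := by
  have hfix : ∀ v : List Side, v.length ≤ n → ∀ P ∉ S, (C v).tree P = (C []).tree P := by
    intro v
    induction v using List.reverseRecOn with
    | nil => intros; rfl
    | append_singleton v d ih =>
      intro hv P hP
      have hv' : v.length ≤ n := by simp at hv; omega
      rw [hC v d P (fun h => hP (h ▸ hS v hv')) (fun h => hP (h ▸ hS _ hv)), ih hv' P hP]
  -- Hence state, pointer and the contents of `S` determine the configuration; each node of `S` is
  -- absent, labelled `⊥`, or labelled by a tree symbol.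
  let f : (Fin n → Bool) → (Q × S) × (S → Option (Option Γ)) := fun x =>
    let v := List.ofFn fun i => if x i then Side.l else Side.r
    (((C v).state, ⟨(C v).pointer, hS v (by simp [v])⟩), fun P => (C v).tree P)
  have hf : Function.Injective f := by
    intro x y hxy
    simp only [f, Prod.mk.injEq, Subtype.mk.injEq] at hxy
    obtain ⟨⟨hq, hp⟩, ht⟩ := hxy
    have hCeq : C (List.ofFn fun i => if x i then Side.l else Side.r) =
        C (List.ofFn fun i => if y i then Side.l else Side.r) := by
      have htree : (C (List.ofFn fun i => if x i then Side.l else Side.r)).tree =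
          (C (List.ofFn fun i => if y i then Side.l else Side.r)).tree := by
        funext P
        by_cases hP : P ∈ S
        · exact congrFun ht ⟨P, hP⟩
        · exact (hfix _ (by simp) P hP).trans (hfix _ (by simp) P hP).symm
      generalize C (List.ofFn fun i => if x i then Side.l else Side.r) = c at *
      generalize C (List.ofFn fun i => if y i then Side.l else Side.r) = c' at *
      cases c
      cases c'
      simp_all
    have := List.ofFn_injective (hinj hCeq)
    funext i
    have := congrFun this i
    cases hx : x i <;> cases hy : y i <;> simp_all
  have hcard := Nat.card_le_card_of_injective f hf
  rw [Nat.card_prod, Nat.card_prod, Nat.card_fun, Nat.card_fun, Finite.card_option,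
    Finite.card_option, Nat.card_fin, Nat.card_eq_fintype_card (α := Bool), Fintype.card_bool,
    Nat.card_eq_fintype_card (α := S), Fintype.card_coe] at hcard
  by_contra hlt
  push Not at hlt
  have h1 : (Nat.card Γ + 2) ^ S.card ≤ (Nat.card Γ + 2) ^ m :=
    Nat.pow_le_pow_right (by omega) hlt.le
  have h2 : Nat.card Q * S.card * (Nat.card Γ + 2) ^ S.card ≤
      Nat.card Q * m * (Nat.card Γ + 2) ^ m :=
    Nat.mul_le_mul (Nat.mul_le_mul_left _ hlt.le) h1
  rw [show Nat.card Γ + 1 + 1 = Nat.card Γ + 2 from rfl] at hcard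
  omega

/-! ### Choice of the parameters -/

/-- The parameters for the lower bound. -/
theorem exists_lower_bound_parameters (q g : ℕ) : ∃ l s m h n : ℕ, 0 < l ∧
    q * 3 ^ (l + 3) * (g + 3) ^ (2 * s + 3) < 2 ^ 2 ^ l ∧
    q * (m * 2 ^ (2 * h + 2)) * (g + 2) ^ (m * 2 ^ (2 * h + 2)) < 2 ^ n ∧
    2 * l * 2 ^ l + 3 + m * n + m * m * 2 ^ (l + 2 - h + 2) < m * s := by
  obtain ⟨e, rfl⟩ : ∃ e, e = q + g + 10 := ⟨_, rfl⟩
  generalize he : q + g + 10 = e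
  -- With `l + 1 = 2 ^ t`, `s = 2 ^ (l - e)` and `m = 2 ^ j`, the product `m * s` is `4 * (l + 1) *
  -- 2 ^ l`. The value of `h` makes the overlaps cost `2 * (l + 1) * 2 ^ l`, and the dictionary
  -- costs `2 * l * 2 ^ l`. This leaves `2 * 2 ^ l` for `m * n + 3`, where `m * n` is at most `2 ^
  -- (4 * t + 7 * e + 21)`; `hgrow` makes `l` large enough for that.
  obtain ⟨t, ht⟩ : ∃ t, t = 7 * e + 30 := ⟨_, rfl⟩
  have two : ∀ k : ℕ, k < 2 ^ k := fun k => Nat.lt_two_pow_self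
  have hgrow : 4 * t + 7 * e + 30 < 2 ^ t := by
    have h1 : 2 ^ t = 32 * 2 ^ (t - 5) := by
      rw [show (32 : ℕ) = 2 ^ 5 by norm_num, ← pow_add]; congr 1; omega
    have h2 := two (t - 5)
    omega
  obtain ⟨l, hl⟩ : ∃ l, l + 1 = 2 ^ t := ⟨2 ^ t - 1, by omega⟩
  obtain ⟨j, hj⟩ : ∃ j, j = t + e + 2 := ⟨_, rfl⟩
  obtain ⟨h, hh⟩ : ∃ h, h = j + e + 5 := ⟨_, rfl⟩
  obtain ⟨M, hM⟩ : ∃ M, M = 2 ^ j * 2 ^ (2 * h + 2) := ⟨_, rfl⟩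
  have hq : q < 2 ^ e := lt_trans (by omega) (two e)
  refine ⟨l, 2 ^ (l - e), 2 ^ j, h, q + (g + 3) * M, by omega, ?_, ?_, ?_⟩
  · have h3 : 3 ^ (l + 3) ≤ 2 ^ (2 * l + 6) := by
      rw [show 2 * l + 6 = 2 * (l + 3) by ring, pow_mul]
      exact Nat.pow_le_pow_left (by norm_num) _
    -- The trees use up about half of the exponent `2 ^ l`; the other half absorbs the states and
    -- the addresses.
    have h4 : (g + 3) ^ (2 * 2 ^ (l - e) + 3) ≤ 2 ^ (2 ^ (l - 1) + 3 * e) := by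
      calc (g + 3) ^ (2 * 2 ^ (l - e) + 3) ≤ (2 ^ (g + 3)) ^ (2 * 2 ^ (l - e) + 3) :=
            Nat.pow_le_pow_left (two _).le _
        _ = 2 ^ ((g + 3) * (2 * 2 ^ (l - e) + 3)) := by rw [← pow_mul]
        _ ≤ 2 ^ (2 ^ (l - 1) + 3 * e) := by
            apply Nat.pow_le_pow_right (by norm_num)
            have h5 : 2 * (g + 3) ≤ 2 ^ (e - 1) := by
              have h6 := two (e - 2)
              have h7 : 2 ^ (e - 1) = 2 * 2 ^ (e - 2) := by
                rw [← pow_succ']; congr 1; omega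
              omega
            have h8 : 2 ^ (l - 1) = 2 ^ (e - 1) * 2 ^ (l - e) := by
              rw [← pow_add]; congr 1; omega
            rw [h8]
            nlinarith [Nat.mul_le_mul_right (2 ^ (l - e)) h5]
    calc q * 3 ^ (l + 3) * (g + 3) ^ (2 * 2 ^ (l - e) + 3)
        ≤ 2 ^ e * 2 ^ (2 * l + 6) * 2 ^ (2 ^ (l - 1) + 3 * e) :=
          Nat.mul_le_mul (Nat.mul_le_mul hq.le h3) h4
      _ = 2 ^ (e + (2 * l + 6) + (2 ^ (l - 1) + 3 * e)) := by rw [← pow_add, ← pow_add]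
      _ < 2 ^ 2 ^ l := by
          apply Nat.pow_lt_pow_right (by norm_num)
          have h9 : 2 ^ l = 2 ^ (l - 1) + 2 ^ (l - 1) := by
            rw [← two_mul, ← pow_succ']; congr 1; omega
          have h10 : 2 ^ (l - 1) = 8 * 2 ^ (l - 4) := by
            rw [show (8 : ℕ) = 2 ^ 3 by norm_num, ← pow_add]; congr 1; omega
          have h11 := two (l - 4)
          omega
  · rw [← hM]
    calc q * M * (g + 2) ^ M < 2 ^ q * 2 ^ M * (2 ^ (g + 2)) ^ M := by
          have a1 : q * M < 2 ^ q * 2 ^ M := Nat.mul_lt_mul'' (two q) (two M)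
          have a2 : (g + 2) ^ M ≤ (2 ^ (g + 2)) ^ M := Nat.pow_le_pow_left (two _).le _
          exact Nat.mul_lt_mul_of_lt_of_le a1 a2 (by positivity)
      _ = 2 ^ (q + (g + 3) * M) := by
          rw [← pow_mul, ← pow_add, ← pow_add]; congr 1; ring
  · have e1 : 2 ^ j * 2 ^ j * 2 ^ (l + 2 - h + 2) = 2 * (l + 1) * 2 ^ l := by
      rw [hl, ← pow_add, ← pow_add, ← pow_succ', ← pow_add]; congr 1; omega
    have e2 : 2 ^ j * 2 ^ (l - e) = 4 * (l + 1) * 2 ^ l := by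
      rw [hl, ← pow_add, show (4 : ℕ) = 2 ^ 2 by norm_num, ← pow_add, ← pow_add]
      congr 1; omega
    have e3 : 2 ^ j * (q + (g + 3) * M) ≤ 2 ^ (4 * t + 7 * e + 21) := by
      have b1 : q + (g + 3) * M ≤ 2 ^ e * M := by
        have : 0 < M := by rw [hM]; positivity
        have : q + (g + 3) ≤ 2 ^ e := (le_trans (by omega) (two e).le)
        nlinarith
      calc 2 ^ j * (q + (g + 3) * M) ≤ 2 ^ j * (2 ^ e * M) := Nat.mul_le_mul_left _ b1
        _ = 2 ^ (4 * t + 7 * e + 20) := by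
            rw [hM, ← pow_add, ← pow_add, ← pow_add]; congr 1; omega
        _ ≤ _ := Nat.pow_le_pow_right (by norm_num) (by omega)
    have e4 : 2 ^ (4 * t + 7 * e + 21) + 3 < 2 * 2 ^ l := by
      have : 2 ^ (4 * t + 7 * e + 23) ≤ 2 ^ l := Nat.pow_le_pow_right (by norm_num) (by omega)
      have h5 : 2 ^ (4 * t + 7 * e + 23) = 4 * 2 ^ (4 * t + 7 * e + 21) := by ring
      have := two (4 * t + 7 * e + 21)
      omega
    rw [e1, e2]
    nlinarith

/-! ### The lower bound argument -/

/-- A language for which every automaton has to store a big dictionary near the pointer and, at the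
same time, a word that is unrelated to the dictionary, is not accepted in real time. -/
theorem TWSDA.false_of_dictionary {α Q Γ : Type} [Finite Q] [Finite Γ] (M : TWSDA α Q Γ)
    (hM : M.RealTime) (letter : Side → α) (pre : ∀ l, Finset (Fin l → Side) → List α)
    (query : ∀ l, (Fin l → Side) → List α) (tail : List Side → List α)
    (hpre : ∀ l X, (pre l X).length ≤ 2 * l * 2 ^ l + 2)
    (hquery : ∀ l y, (query l y).length = l + 1)
    (hdict : ∀ l X (v : List Side) y, 0 < l → (pre l X ++ v.map letter ++ query l y ∈ M.accepted ↔ y ∈ X))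
    (hstack : ∀ l X v v', pre l X ++ v.map letter ++ tail v' ∈ M.accepted ↔ v = v') : False := by
  classical
  obtain ⟨l, s, m, h, n, hl, hcount, hpigeon, hsize⟩ :=
    exists_lower_bound_parameters (Nat.card Q) (Nat.card Γ)
  have hsplit : ∀ (w u : List α), withEnd (w ++ u) = w.map InputSymbol.letter ++ withEnd u := by
    intro w u
    simp [withEnd]
  -- The continuation `tail v` yields an accepted word, so the run cannot get stuck before it.
  have hrun : ∀ X (v : List Side), ∃ c, M.run M.initSnap ((pre l X ++ v.map letter).map InputSymbol.letter) =
      some c := by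
    intro X v
    have := (hstack l X v v).2 rfl
    rw [M.mem_accepted_iff hM, hsplit, M.acceptsFrom_append] at this
    exact this.imp fun c hc => hc.1
  choose C hC using hrun
  have hfrom : ∀ X (v : List Side) u, pre l X ++ v.map letter ++ u ∈ M.accepted ↔
      M.AcceptsFrom (C X v) (withEnd u) := by
    intro X v u
    rw [M.mem_accepted_iff hM, hsplit, M.acceptsFrom_append, hC X v]
    simp
  have hnext : ∀ X v d, M.next (C X v) (InputSymbol.letter (letter d)) = some (C X (v ++ [d])) := by
    intro X v d
    have h1 := hC X (v ++ [d])
    rw [List.map_append (f := letter), ← List.append_assoc, List.map_append, M.run_append,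
      hC X v] at h1
    simpa [TWSDA.run] using h1
  -- Otherwise each `X` has a continuation `v X` with fewer than `s` nodes nearby. Queries of length
  -- `l + 2`, endmarker included, tell these configurations apart, so there would be as many small
  -- views as dictionaries.
  obtain ⟨X, hX⟩ : ∃ X, ∀ v, s ≤ ((C X v).near (l + 2)).card := by
    by_contra hcon
    push Not at hcon
    choose v hv using hcon
    have h1 := card_le_of_locallyEq (fun X => C X (v X))
      (fun X => (M.isGammaTree_of_run (hC X (v X))).1) (fun X => (hv X).le) (by
        intro X Y hXY
        have hlen : ∀ y, (withEnd (query l y)).length = l + 2 := by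
          intro y; simp [withEnd, hquery]
        ext y
        rw [← hdict l X (v X) y hl, ← hdict l Y (v Y) y hl, hfrom, hfrom]
        refine ⟨fun hacc => TWSDA.AcceptsFrom.of_locallyEq M hacc (by rwa [hlen]),
          fun hacc => TWSDA.AcceptsFrom.of_locallyEq M hacc ?_⟩
        rw [hlen]
        exact hXY.symm)
    have hside : Fintype.card (Fin l → Bool) = 2 ^ l := by simp
    have h2 : 2 ^ 2 ^ l ≤ Nat.card (Finset (Fin l → Side)) := by
      rw [← hside, ← Fintype.card_finset, ← Nat.card_eq_fintype_card]
      refine Nat.card_le_card_of_injective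
        (fun Y => Y.image fun (x : Fin l → Bool) i => if x i then Side.l else Side.r) ?_
      apply Finset.image_injective
      intro x y hxy
      funext i
      have := congrFun hxy i
      cases hx : x i <;> cases hy : y i <;> simp_all
    exact absurd (h2.trans h1) (not_le.2 hcount)
  have hinj : Function.Injective (C X) := by
    intro v v' hvv
    have h1 := (hstack l X v v).2 rfl
    rw [hfrom, hvv, ← hfrom] at h1
    exact ((hstack l X v' v).1 h1).symm
  let S := (shallowNodes n).image fun v => (C X v).pointer
  have hS : m * 2 ^ (2 * h + 2) ≤ S.card :=
    le_card_of_distinct (C := C X)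
      (fun v d P hP hP' => M.tree_eq_of_next (hnext X v d) hP hP') hinj
      (fun v hv => Finset.mem_image.2 ⟨v, mem_shallowNodes.2 hv, rfl⟩) hpigeon
  obtain ⟨A, hAS, hAm, hsep⟩ := exists_separated_subset S h m hS
  have hv : ∀ P ∈ A, ∃ v : List Side, v.length ≤ n ∧ (C X v).pointer = P := by
    intro P hP
    obtain ⟨v, hv, hvP⟩ := Finset.mem_image.1 (hAS hP)
    exact ⟨v, mem_shallowNodes.1 hv, hvP⟩
  choose! v hvn hvP using hv
  have hunion := card_mul_le_card_biUnion_add A (fun P => (C X (v P)).near (l + 2)) s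
    (2 ^ (l + 2 - h + 2)) (fun P _ => hX _) (by
      intro P hP P' hP' hne
      have hsub : (C X (v P)).near (l + 2) ∩ (C X (v P')).near (l + 2) ⊆
          nodeBall P (l + 2) ∩ nodeBall P' (l + 2) := by
        apply Finset.inter_subset_inter
        · exact (Finset.filter_subset _ _).trans (by rw [hvP P hP])
        · exact (Finset.filter_subset _ _).trans (by rw [hvP P' hP'])
      refine (Finset.card_le_card hsub).trans ?_
      rcases hsep P hP P' hP' hne with hfar | hfar
      · exact card_nodeBall_inter_le hfar _
      · rw [Finset.inter_comm]
        exact card_nodeBall_inter_le hfar _)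
  obtain ⟨F, hF, hFdom⟩ := M.exists_finset_of_run (hC X [])
  have hG : ∀ v, ∃ G : Finset Node, G.card ≤ v.length ∧
      ∀ P, ((C X v).tree P).isSome → ((C X []).tree P).isSome ∨ P ∈ G := by
    intro v
    obtain ⟨G, hG, hGdom⟩ := M.exists_finset_of_run (c := C X []) (c' := C X v)
      (w := (v.map letter).map InputSymbol.letter) (by
        have h1 := hC X v
        have h2 := hC X []
        rw [List.map_nil, List.append_nil] at h2
        rwa [List.map_append, M.run_append, h2] at h1)
    exact ⟨G, by simpa using hG, hGdom⟩
  choose G hGcard hGdom using hG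
  -- The trees belong to different continuations, but each of their nodes is the root, was pushed
  -- while the common dictionary was read, or is one of the at most `n` nodes added by its own
  -- continuation.
  have hsub : (A.biUnion fun P => (C X (v P)).near (l + 2)) ⊆
      insert [] F ∪ A.biUnion fun P => G (v P) := by
    intro u hu
    obtain ⟨P, hP, hu⟩ := Finset.mem_biUnion.1 hu
    have hu := (Finset.mem_filter.1 hu).2
    rcases hGdom _ _ hu with hu | hu
    · refine Finset.mem_union_left _ ?_
      rcases hFdom _ hu with hu | hu
      · by_cases hroot : u = []
        · simp [hroot]
        · simp [TWSDA.initSnap, hroot] at hu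
      · exact Finset.mem_insert_of_mem hu
    · exact Finset.mem_union_right _ (Finset.mem_biUnion.2 ⟨P, hP, hu⟩)
  have hle := Finset.card_le_card hsub
  have hle1 := Finset.card_union_le (insert [] F) (A.biUnion fun P => G (v P))
  have hle2 := Finset.card_insert_le [] F
  have hle3 : (A.biUnion fun P => G (v P)).card ≤ A.card * n :=
    Finset.card_biUnion_le_card_mul _ _ _ fun P hP => (hGcard _).trans (hvn P hP)
  have hle4 := hpre l X
  simp only [List.map_nil, List.append_nil, List.length_map] at hF
  rw [hAm] at hunion hle3
  omega

/-! ### Dictionaries and the language with merged hints -/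

/-- The letter that belongs to a direction. -/
def Side.toBase : Side → BaseSymbol
  | Side.l => BaseSymbol.a
  | Side.r => BaseSymbol.b

theorem Side.toBase_injective : Function.Injective Side.toBase := by
  intro d e h
  cases d <;> cases e <;> first | rfl | cases h

/-- The words `x₁ $^|x₁| ⋯ x_k $^|x_k|`. -/
def dollarCode (xs : List (List BaseSymbol)) : List BaseSymbol :=
  xs.flatMap fun x => x ++ List.replicate x.length BaseSymbol.dollar

theorem dollarCode_cons (x : List BaseSymbol) (xs : List (List BaseSymbol)) :
    dollarCode (x :: xs) = x ++ List.replicate x.length BaseSymbol.dollar ++ dollarCode xs := by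
  simp [dollarCode]

theorem isWordAB_map_toBase (v : List Side) : IsWordAB (v.map Side.toBase) := by
  intro s hs
  obtain ⟨d, -, rfl⟩ := List.mem_map.1 hs
  cases d
  · exact Or.inl rfl
  · exact Or.inr rfl

theorem IsWordAB.isWordABDollar {x : List BaseSymbol} (h : IsWordAB x) : IsWordABDollar x :=
  fun s hs => (h s hs).imp_right Or.inl

theorem isWordABDollar_dollarCode {xs : List (List BaseSymbol)} (h : ∀ x ∈ xs, IsWordAB x) :
    IsWordABDollar (dollarCode xs) := by
  intro s hs
  obtain ⟨x, hx, hs⟩ := List.mem_flatMap.1 hs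
  rcases List.mem_append.1 hs with hs | hs
  · exact (h x hx).isWordABDollar s hs
  · exact Or.inr (Or.inr (List.eq_of_mem_replicate hs))

theorem IsWordAB.dollar_notMem {x : List BaseSymbol} (h : IsWordAB x) : BaseSymbol.dollar ∉ x := by
  intro hs
  rcases h _ hs with h | h <;> cases h

theorem IsWordABDollar.notMem {x : List BaseSymbol} (h : IsWordABDollar x) :
    BaseSymbol.cent ∉ x ∧ BaseSymbol.border1 ∉ x ∧ BaseSymbol.border2 ∉ x := by
  refine ⟨fun hs => ?_, fun hs => ?_, fun hs => ?_⟩ <;> rcases h _ hs with h | h | h <;> cases h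

theorem append_cons_inj_of_notMem_left {β : Type} {a : β} {x x' s s' : List β} (hx : a ∉ x)
    (hx' : a ∉ x') (h : x ++ a :: s = x' ++ a :: s') : x = x' ∧ s = s' := by
  induction x generalizing x' with
  | nil =>
    cases x' with
    | nil => simpa using h
    | cons b x' => simp at h hx'; exact absurd h.1 hx'.1
  | cons b x ih =>
    cases x' with
    | nil => simp at h hx; exact absurd h.1.symm hx.1
    | cons b' x' =>
      simp only [List.cons_append, List.cons.injEq] at h
      simp only [List.mem_cons, not_or] at hx hx'
      obtain ⟨h1, h2⟩ := ih hx.2 hx'.2 h.2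
      exact ⟨by rw [h.1, h1], h2⟩

/-- The letters before the first `$` form the first nonempty word, and its length tells how many `$`
belong to it. Empty words leave no trace in the code, so `xs'` may have to be searched past some of
them; `zs` is what follows the match. -/
theorem exists_dollarCode_eq_of_cons {x : List BaseSymbol} {xs xs' : List (List BaseSymbol)}
    (hx : IsWordAB x) (hne : x ≠ []) (hxs' : ∀ y ∈ xs', IsWordAB y)
    (h : dollarCode (x :: xs) = dollarCode xs') :
    x ∈ xs' ∧ ∃ zs ⊆ xs', dollarCode xs = dollarCode zs := by
  induction xs' with
  | nil =>
    rw [dollarCode_cons] at h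
    simp [dollarCode, hne] at h
  | cons x' xs' ih =>
    by_cases hx'ne : x' = []
    · subst hx'ne
      obtain ⟨h1, zs, h2, h3⟩ := ih (fun y hy => hxs' y (List.mem_cons_of_mem _ hy))
        (by simpa [dollarCode_cons] using h)
      exact ⟨List.mem_cons_of_mem _ h1, zs, fun y hy => List.mem_cons_of_mem _ (h2 hy), h3⟩
    · have hx' := hxs' x' List.mem_cons_self
      have hrep : ∀ (y : List BaseSymbol) (E : List BaseSymbol), y ≠ [] →
          y ++ List.replicate y.length BaseSymbol.dollar ++ E =
          y ++ BaseSymbol.dollar :: (List.replicate (y.length - 1) BaseSymbol.dollar ++ E) := by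
        intro y E hy
        obtain ⟨k, hk⟩ : ∃ k, y.length = k + 1 :=
          Nat.exists_eq_succ_of_ne_zero (by simpa using hy)
        simp [hk, List.replicate_succ]
      rw [dollarCode_cons, dollarCode_cons, hrep _ _ hne, hrep _ _ hx'ne] at h
      obtain ⟨rfl, h⟩ := append_cons_inj_of_notMem_left hx.dollar_notMem hx'.dollar_notMem h
      exact ⟨List.mem_cons_self, xs', fun y hy => List.mem_cons_of_mem _ hy,
        List.append_cancel_left h⟩

theorem mem_of_dollarCode_eq {xs xs' : List (List BaseSymbol)} (hxs : ∀ x ∈ xs, IsWordAB x)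
    (hxs' : ∀ x ∈ xs', IsWordAB x) (h : dollarCode xs = dollarCode xs') {y : List BaseSymbol}
    (hy : y ∈ xs) (hne : y ≠ []) : y ∈ xs' := by
  induction xs generalizing xs' with
  | nil => simp at hy
  | cons x xs ih =>
    have hxs₂ : ∀ x ∈ xs, IsWordAB x := fun z hz => hxs z (List.mem_cons_of_mem _ hz)
    by_cases hx : x = []
    · subst hx
      exact ih hxs₂ hxs' (by simpa [dollarCode_cons] using h) (by simpa [hne] using hy)
    · obtain ⟨h1, zs, hzs, h2⟩ := exists_dollarCode_eq_of_cons (hxs x List.mem_cons_self) hx hxs' h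
      rcases List.mem_cons.1 hy with rfl | hy
      · exact h1
      · exact hzs (ih hxs₂ (fun z hz => hxs' z (hzs hz)) h2 hy)

theorem mem_homImage_hintedLanguage (u : List BaseSymbol) :
    MergedSymbol.hint :: u.map MergedSymbol.sym ∈ homImage mergeHints hintedLanguage ↔
      u ∈ hatLp ∨ u ∈ hatLmi := by
  have hmerge : ∀ v : List BaseSymbol, (v.map HintedSymbol.sym).map mergeSymbol =
      v.map MergedSymbol.sym := by
    intro v
    rw [List.map_map]
    rfl
  have hhom : ∀ w : List HintedSymbol,
      FreeMonoid.toList (mergeHints (FreeMonoid.ofList w)) = w.map mergeSymbol := fun _ => rfl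
  have hsym : Function.Injective MergedSymbol.sym := fun s t h => by cases h; rfl
  constructor
  · rintro ⟨w, hw | hw, h⟩ <;> obtain ⟨v, hv, rfl⟩ := hw <;>
      rw [hhom, List.map_cons, hmerge] at h <;>
      obtain rfl := (List.map_injective_iff.2 hsym) (List.cons.inj h).2
    · exact Or.inl hv
    · exact Or.inr hv
  · rintro (hu | hu)
    · exact ⟨_, Or.inl ⟨u, hu, rfl⟩, by rw [hhom, List.map_cons, hmerge]; rfl⟩
    · exact ⟨_, Or.inr ⟨u, hu, rfl⟩, by rw [hhom, List.map_cons, hmerge]; rfl⟩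

theorem border1_mem_of_mem_hatLp {u : List BaseSymbol} (h : u ∈ hatLp) :
    BaseSymbol.border1 ∈ u := by
  obtain ⟨xs, z, y, -, -, -, -, rfl⟩ := h
  simp

theorem border1_notMem_of_mem_hatLmi {u : List BaseSymbol} (h : u ∈ hatLmi) :
    BaseSymbol.border1 ∉ u := by
  obtain ⟨x, v, hx, hv, rfl⟩ := h
  simp [hx.notMem.2.1, hv.isWordABDollar.notMem.2.1]

/-- The dictionary of the words in a set of words of the same length. -/
noncomputable def dictionary (l : ℕ) (X : Finset (Fin l → Side)) : List (List BaseSymbol) :=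
  X.toList.map fun x => (List.ofFn x).map Side.toBase

theorem isWordAB_of_mem_dictionary {l : ℕ} {X : Finset (Fin l → Side)} {x : List BaseSymbol}
    (hx : x ∈ dictionary l X) : IsWordAB x := by
  obtain ⟨x, -, rfl⟩ := List.mem_map.1 hx
  exact isWordAB_map_toBase _

theorem length_of_mem_dictionary {l : ℕ} {X : Finset (Fin l → Side)} {x : List BaseSymbol}
    (hx : x ∈ dictionary l X) : x.length = l := by
  obtain ⟨x, -, rfl⟩ := List.mem_map.1 hx
  simp

theorem mem_dictionary {l : ℕ} {X : Finset (Fin l → Side)} {y : Fin l → Side} :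
    (List.ofFn y).map Side.toBase ∈ dictionary l X ↔ y ∈ X := by
  simp only [dictionary, List.mem_map, Finset.mem_toList]
  constructor
  · rintro ⟨x, hx, h⟩
    rwa [← List.ofFn_injective ((List.map_injective_iff.2 Side.toBase_injective) h)]
  · exact fun h => ⟨y, h, rfl⟩

theorem length_dollarCode_dictionary (l : ℕ) (X : Finset (Fin l → Side)) :
    (dollarCode (dictionary l X)).length ≤ 2 * l * 2 ^ l := by
  have h1 : ∀ xs : List (List BaseSymbol), (∀ x ∈ xs, x.length = l) →
      (dollarCode xs).length = xs.length * (2 * l) := by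
    intro xs
    induction xs with
    | nil => intro; simp [dollarCode]
    | cons x xs ih =>
      intro h
      have h2 := h x List.mem_cons_self
      have h3 := ih fun y hy => h y (List.mem_cons_of_mem _ hy)
      simp only [dollarCode_cons, List.length_append, List.length_replicate, h2, h3,
        List.length_cons]
      ring
  have h4 : X.card ≤ 2 ^ l := by
    have : Fintype Side := Fintype.ofFinite Side
    have hside : Fintype.card Side = 2 := by
      rw [← Nat.card_eq_fintype_card, Nat.card_eq_two_iff]
      exact ⟨Side.l, Side.r, by simp, by ext d; cases d <;> simp⟩
    refine (Finset.card_le_univ X).trans (le_of_eq ?_)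
    rw [Fintype.card_fun, hside, Fintype.card_fin]
  rw [h1 _ fun x hx => length_of_mem_dictionary hx]
  simp only [dictionary, List.length_map, Finset.length_toList]
  rw [mul_comm]
  exact Nat.mul_le_mul_left _ h4

/-- The symbol `#₁` excludes L̂_mi, and ¢ and `#₁` fix the factorisation. Words of equal length
satisfy the prefix condition. Positive length is needed because the code does not show empty words.
-/
theorem dictionary_query_mem_iff {l : ℕ} (hl : 0 < l) (X : Finset (Fin l → Side)) (v : List Side)
    (y : Fin l → Side) :
    (dollarCode (dictionary l X) ++ BaseSymbol.cent :: (v.map Side.toBase ++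
      BaseSymbol.border1 :: (List.ofFn y).map Side.toBase) ∈ hatLp ∨
    dollarCode (dictionary l X) ++ BaseSymbol.cent :: (v.map Side.toBase ++
      BaseSymbol.border1 :: (List.ofFn y).map Side.toBase) ∈ hatLmi) ↔ y ∈ X := by
  have hv := (isWordAB_map_toBase v).isWordABDollar
  constructor
  · rintro (⟨xs, z, y', hxs, hz, -, hy', h⟩ | h)
    · change _ = dollarCode xs ++ _ ++ _ ++ _ ++ _ at h
      simp only [List.append_assoc, List.singleton_append] at h
      obtain ⟨h1, h⟩ := append_cons_inj_of_notMem_left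
        (isWordABDollar_dollarCode fun _ => isWordAB_of_mem_dictionary).notMem.1
        (isWordABDollar_dollarCode hxs).notMem.1 h
      obtain ⟨-, rfl⟩ := append_cons_inj_of_notMem_left hv.notMem.2.1 hz.notMem.2.1 h
      refine mem_dictionary.1 (mem_of_dollarCode_eq hxs (fun _ => isWordAB_of_mem_dictionary)
        h1.symm hy' ?_)
      intro h0
      have := congrArg List.length h0
      simp at this
      omega
    · exact absurd (by simp) (border1_notMem_of_mem_hatLmi h)
  · intro hy
    refine Or.inl ⟨dictionary l X, v.map Side.toBase, (List.ofFn y).map Side.toBase,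
      fun _ => isWordAB_of_mem_dictionary, hv, ?_, mem_dictionary.2 hy, ?_⟩
    · apply List.pairwise_of_forall_mem_list
      rintro x hx x' hx' ⟨hpre, hne⟩
      exact hne (hpre.eq_of_length
        (by rw [length_of_mem_dictionary hx, length_of_mem_dictionary hx']))
    · change _ = dollarCode _ ++ _ ++ _ ++ _ ++ _
      simp

/-- The absence of `#₁` excludes L̂_p, and ¢ together with the first `$` after it delimits `v`. -/
theorem dictionary_stack_mem_iff {l : ℕ} (X : Finset (Fin l → Side)) (v v' : List Side) :
    (dollarCode (dictionary l X) ++ BaseSymbol.cent :: (v.map Side.toBase ++ BaseSymbol.dollar ::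
      ((v'.map Side.toBase).reverse ++ [BaseSymbol.border2])) ∈ hatLp ∨
    dollarCode (dictionary l X) ++ BaseSymbol.cent :: (v.map Side.toBase ++ BaseSymbol.dollar ::
      ((v'.map Side.toBase).reverse ++ [BaseSymbol.border2])) ∈ hatLmi) ↔ v = v' := by
  have hX := isWordABDollar_dollarCode fun x => isWordAB_of_mem_dictionary (l := l) (X := X) (x := x)
  have hab := fun v => isWordAB_map_toBase v
  constructor
  · rintro (h | ⟨x, u, hx, hu, h⟩)
    · have h1 := border1_mem_of_mem_hatLp h
      simp [hX.notMem.2.1, (hab v).isWordABDollar.notMem.2.1, -List.mem_map,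
        (hab v').isWordABDollar.notMem.2.1] at h1
    · simp only [List.append_assoc, List.singleton_append] at h
      obtain ⟨-, h⟩ := append_cons_inj_of_notMem_left hX.notMem.1 hx.notMem.1 h
      obtain ⟨rfl, h⟩ := append_cons_inj_of_notMem_left (hab v).dollar_notMem hu.dollar_notMem h
      have h2 := List.append_cancel_right h
      exact ((List.map_injective_iff.2 Side.toBase_injective) (List.reverse_injective h2)).symm
  · rintro rfl
    exact Or.inr ⟨_, _, hX, hab v, by simp⟩

/-- The language with merged hints is not accepted in real time. -/
theorem homImage_mergeHints_notMem_rtTWSDA :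
    homImage mergeHints hintedLanguage ∉ rtTWSDA MergedSymbol := by
  rintro ⟨Q, Γ, _, _, M, hM, hacc⟩
  refine M.false_of_dictionary hM (MergedSymbol.sym ∘ Side.toBase)
    (fun l X => MergedSymbol.hint :: (dollarCode (dictionary l X) ++ [BaseSymbol.cent]).map
      MergedSymbol.sym)
    (fun l y => (BaseSymbol.border1 :: (List.ofFn y).map Side.toBase).map MergedSymbol.sym)
    (fun v => (BaseSymbol.dollar :: ((v.map Side.toBase).reverse ++ [BaseSymbol.border2])).map
      MergedSymbol.sym) ?_ ?_ ?_ ?_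
  · intro l X
    have := length_dollarCode_dictionary l X
    simp
    omega
  · intro l y
    simp
  · intro l X v y hl
    rw [hacc, ← dictionary_query_mem_iff hl X v y, ← mem_homImage_hintedLanguage]
    simp
  · intro l X v v'
    rw [hacc, ← dictionary_stack_mem_iff X v v', ← mem_homImage_hintedLanguage]
    simp

/-! ### The automaton for the hinted language -/

/-- The direction that belongs to a letter. -/
def BaseSymbol.toSide : BaseSymbol → Option Side
  | .a => some Side.l
  | .b => some Side.r
  | _ => none

/-- States of an automaton for the hinted language. In the first branch, `word d` means that the
last letter of a dictionary word, with direction `d`, has not been stored yet, `climb` that the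
pointer returns to the root, where `climb true` still has to check that the pointer is at a leaf. -/
inductive RecState : Type where
  | start
  | word (d : Side)
  | climb (fresh : Bool)
  | skip
  | look
  | stackSkip
  | stackPush
  | stackPop
  | stackEnd
  | accept
deriving DecidableEq

instance : Finite RecState := by
  refine Set.finite_univ_iff.1 (Set.Finite.subset
    (Set.toFinite ({.start, .word Side.l, .word Side.r, .climb true, .climb false, .skip, .look,
      .stackSkip, .stackPush, .stackPop, .stackEnd, .accept} : Set RecState)) ?_)
  intro q _
  rcases q with _ | d | f | _ | _ | _ | _ | _ | _ | _ <;> try simp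
  cases d <;> simp

/-- Move to a descendant, which is created with label `x` if it does not exist. -/
def enterAction {Γ : Type} (t : NodeType) (d : Side) (x : Γ) : StorageAction Γ :=
  if t.has d then .down d else .push x d

/-- Move up except at the root. -/
def upAction {Γ : Type} (t : NodeType) : StorageAction Γ :=
  if t.pos = none then .stay else .up

theorem legal_enterAction {Γ : Type} (t : NodeType) (d : Side) (x : Γ) :
    (enterAction t d x).Legal t := by
  unfold enterAction
  split
  · assumption
  · exact Bool.eq_false_iff.2 ‹_›

theorem legal_upAction {Γ : Type} (t : NodeType) : (upAction t : StorageAction Γ).Legal t := by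
  unfold upAction
  split
  · trivial
  · assumption

/-- Transitions for input letters. The label of a node tells whether its depth is one and whether
it is the end of a dictionary word. -/
def recLetter : RecState → HintedSymbol → NodeType → Option (Bool × Bool) →
    Option (RecState × StorageAction (Bool × Bool))
  | .start, .hint1, _, _ => some (.climb false, .stay)
  | .start, .hint2, _, _ => some (.stackSkip, .stay)
  | .climb fresh, .sym s, t, x =>
    if fresh && (t.hasLeft || t.hasRight) then none
    else if x = none ∨ x.map Prod.fst = some true then
      match s.toSide, s with
      | some d, _ => some (.word d, upAction t)
      | none, .cent => some (.skip, upAction t)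
      | none, _ => none
    else
      match s with
      | .dollar => some (.climb false, upAction t)
      | _ => none
  | .word d, .sym s, t, _ =>
    match s.toSide, s with
    | some e, _ => some (.word e, enterAction t d (t.pos.isNone, false))
    | none, .dollar => some (.climb true, enterAction t d (t.pos.isNone, true))
    | none, _ => none
  | .skip, .sym s, _, _ =>
    match s.toSide, s with
    | some _, _ => some (.skip, .stay)
    | none, .dollar => some (.skip, .stay)
    | none, .border1 => some (.look, .stay)
    | none, _ => none
  | .look, .sym s, t, _ =>
    match s.toSide with
    | some d => if t.has d then some (.look, enterAction t d (false, false)) else none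
    | none => none
  | .stackSkip, .sym s, _, _ =>
    match s.toSide, s with
    | some _, _ => some (.stackSkip, .stay)
    | none, .dollar => some (.stackSkip, .stay)
    | none, .cent => some (.stackPush, .stay)
    | none, _ => none
  | .stackPush, .sym s, t, _ =>
    match s.toSide, s with
    | some d, _ => some (.stackPush, enterAction t d (t.pos.isNone, false))
    | none, .dollar => some (.stackPop, .stay)
    | none, _ => none
  | .stackPop, .sym s, t, _ =>
    match s.toSide, s with
    | some d, _ => if t.pos = some d then some (.stackPop, upAction t) else none
    | none, .border2 => if t.pos = none then some (.stackEnd, .stay) else none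
    | none, _ => none
  | _, _, _, _ => none

/-- Transitions for the endmarker. -/
def recEnd : RecState → Option (Bool × Bool) → Option (RecState × StorageAction (Bool × Bool))
  | .look, x => if x = none ∨ x.map Prod.snd = some true then some (.accept, .stay) else none
  | .stackEnd, _ => some (.accept, .stay)
  | _, _ => none

/-- This one case analysis yields both the legality of the operations and the absence of pops. -/
theorem recLetter_action {q : RecState} {s : HintedSymbol} {t : NodeType}
    {x : Option (Bool × Bool)} {q' : RecState} {act : StorageAction (Bool × Bool)}
    (h : recLetter q s t x = some (q', act)) :
    act = .stay ∨ act = upAction t ∨ ∃ d y, act = enterAction t d y := by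
  unfold recLetter at h
  split at h <;> (try split at h) <;> (try split at h) <;> (try split at h) <;>
    first
    | (simp only [Option.some.injEq, Prod.mk.injEq] at h
       obtain ⟨-, rfl⟩ := h
       first
       | exact Or.inl rfl
       | exact Or.inr (Or.inl rfl)
       | exact Or.inr (Or.inr ⟨_, _, rfl⟩))
    | cases h

theorem recEnd_action {q : RecState} {x : Option (Bool × Bool)} {q' : RecState}
    {act : StorageAction (Bool × Bool)} (h : recEnd q x = some (q', act)) : act = .stay := by
  unfold recEnd at h
  split at h <;> (try split at h) <;> simp_all

/-- A real-time automaton for the hinted language. -/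
def hintedAutomaton : TWSDA HintedSymbol RecState (Bool × Bool) where
  start := .start
  accept := {.accept}
  δ := fun q i t x =>
    match i with
    | none => none
    | some (.letter s) => recLetter q s t x
    | some .endmarker => recEnd q x
  no_choice := fun _ _ _ h => absurd rfl h
  legal := by
    intro q i t x q' act h
    match i, h with
    | some (.letter s), h =>
      rcases recLetter_action h with rfl | rfl | ⟨d, y, rfl⟩
      · trivial
      · exact legal_upAction t
      · exact legal_enterAction t d y
    | some .endmarker, h =>
      obtain rfl := recEnd_action h
      trivial

theorem hintedAutomaton_realTime : hintedAutomaton.RealTime := fun _ _ _ => rfl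

theorem hintedAutomaton_nonErasing : hintedAutomaton.NonErasing := by
  intro q i t x q' h
  match i, h with
  | some (.letter s), h =>
    rcases recLetter_action h with h | h | ⟨d, y, h⟩
    · cases h
    · unfold upAction at h
      split at h <;> cases h
    · unfold enterAction at h
      split at h <;> cases h
  | some .endmarker, h => cases recEnd_action h

/-! ### Tries as storage contents -/

/-- `P` is a node on the path to one of the words of `xs`. -/
def OnPath (xs : List Node) (P : Node) : Prop := ∃ x ∈ xs, P <:+ x

theorem OnPath.of_cons {xs : List Node} {d : Side} {P : Node} (h : OnPath xs (d :: P)) :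
    OnPath xs P := by
  obtain ⟨x, hx, hP⟩ := h
  exact ⟨x, hx, (List.suffix_cons d P).trans hP⟩

theorem onPath_cons {x : Node} {xs : List Node} {P : Node} :
    OnPath (x :: xs) P ↔ P <:+ x ∨ OnPath xs P := by
  simp only [OnPath, List.exists_mem_cons_iff]

open Classical in
/-- The tree that stores the words of `xs` and the path to `u`. -/
noncomputable def trie (xs : List Node) (u : Node) : Labelling (Bool × Bool) := fun P =>
  if P = [] then some none
  else if OnPath xs P ∨ P <:+ u then some (some (decide (P.length = 1), decide (P ∈ xs)))
  else none

theorem trie_nil (xs : List Node) (u : Node) : trie xs u [] = some none := by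
  simp [trie]

open Classical in
theorem trie_cons {xs : List Node} {u : Node} {d : Side} {P : Node}
    (h : OnPath xs (d :: P) ∨ d :: P <:+ u) :
    trie xs u (d :: P) = some (some (P.isEmpty, decide (d :: P ∈ xs))) := by
  have h1 : decide (P.length = 0) = P.isEmpty := by cases P <;> simp
  have h2 : ((d :: P).length = 1) = (P.length = 0) := by simp
  simp only [trie, h, if_true, h2, h1, reduceCtorEq, if_false]

theorem isSome_trie_cons {xs : List Node} {u : Node} {d : Side} {P : Node} :
    (trie xs u (d :: P)).isSome ↔ OnPath xs (d :: P) ∨ d :: P <:+ u := by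
  unfold trie
  by_cases h : OnPath xs (d :: P) ∨ d :: P <:+ u <;> simp [h]

theorem not_cons_suffix_self (d : Side) (u : Node) : ¬ d :: u <:+ u := fun h => by
  have := h.length_le
  simp at this

theorem trie_cons_of_onPath {xs : List Node} {u : Node} {d : Side} (h : OnPath xs (d :: u)) :
    trie xs (d :: u) = trie xs u := by
  classical
  funext P
  have : (OnPath xs P ∨ P <:+ d :: u) ↔ (OnPath xs P ∨ P <:+ u) := by
    rw [List.suffix_cons_iff]
    constructor
    · rintro (h1 | rfl | h1)
      · exact Or.inl h1
      · exact Or.inl h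
      · exact Or.inr h1
    · tauto
  simp [trie, this]

theorem trie_path_of_onPath {xs : List Node} {u : Node} (h : OnPath xs u) :
    trie xs u = trie xs [] := by
  classical
  funext P
  have : (OnPath xs P ∨ P <:+ u) ↔ (OnPath xs P ∨ P <:+ []) := by
    obtain ⟨x, hx, hu⟩ := h
    constructor
    · rintro (h1 | h1)
      · exact Or.inl h1
      · exact Or.inl ⟨x, hx, h1.trans hu⟩
    · rintro (h1 | h1)
      · exact Or.inl h1
      · exact Or.inr (h1.trans List.nil_suffix)
  simp only [trie, this]

theorem update_trie_path {xs : List Node} {u : Node} {d : Side} (h : ¬ OnPath xs (d :: u)) :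
    Function.update (trie xs u) (d :: u) (some (some (u.head?.isNone, false))) =
      trie xs (d :: u) := by
  classical
  funext P
  by_cases hP : P = d :: u
  · subst hP
    have hmem : d :: u ∉ xs := fun hm => h ⟨_, hm, List.suffix_rfl⟩
    cases u <;> simp [trie, hmem]
  · simp [trie, List.suffix_cons_iff, hP]

/-- A marked new node turns the path under construction into a dictionary word, so no separate path
remains. -/
theorem update_trie_end {xs : List Node} {u : Node} {d : Side} (h : ¬ OnPath xs (d :: u)) :
    Function.update (trie xs u) (d :: u) (some (some (u.head?.isNone, true))) =
      trie ((d :: u) :: xs) [] := by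
  classical
  funext P
  have hpath : OnPath ((d :: u) :: xs) P ↔ P = d :: u ∨ OnPath xs P ∨ P <:+ u := by
    rw [onPath_cons, List.suffix_cons_iff]
    tauto
  by_cases hP : P = d :: u
  · subst hP
    cases u <;> simp [trie, hpath]
  · by_cases hn : P = []
    · simp [trie, hn]
    · simp [trie, hpath, hP, hn]

/-- A repeated word needs no change of the tree, since its node already carries the end mark. -/
theorem trie_end_of_mem {xs : List Node} {u : Node} {d : Side} (h : d :: u ∈ xs) :
    trie ((d :: u) :: xs) [] = trie xs u := by
  classical
  funext P
  have hpath : (OnPath ((d :: u) :: xs) P ∨ P <:+ []) ↔ (OnPath xs P ∨ P <:+ []) := by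
    rw [onPath_cons]
    constructor
    · rintro ((h1 | h1) | h1)
      · exact Or.inl ⟨_, h, h1⟩
      · exact Or.inl h1
      · exact Or.inr h1
    · tauto
  have hpath2 : (OnPath xs P ∨ P <:+ u) ↔ (OnPath xs P ∨ P <:+ []) := by
    constructor
    · rintro (h1 | h1)
      · exact Or.inl h1
      · exact Or.inl ⟨_, h, h1.trans (List.suffix_cons d u)⟩
    · rintro (h1 | h1)
      · exact Or.inl h1
      · exact Or.inr (h1.trans (List.nil_suffix))
  have hmem : P ∈ (d :: u) :: xs ↔ P ∈ xs := by
    rw [List.mem_cons]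
    exact ⟨fun h1 => h1.elim (fun h2 => h2 ▸ h) id, Or.inr⟩
  simp only [trie, hpath, hpath2, hmem]

/-- `y` is a proper ancestor of a word of `xs`. -/
def ProperlyOnPath (xs : List Node) (y : Node) : Prop := ∃ x ∈ xs, y <:+ x ∧ y ≠ x

/-- This turns the prefix condition into a test of the node type: the node reached must not have a
descendant. -/
theorem properlyOnPath_iff {xs : List Node} {y : Node} :
    ProperlyOnPath xs y ↔ ∃ d, OnPath xs (d :: y) := by
  constructor
  · rintro ⟨x, hx, ⟨p, rfl⟩, hne⟩
    obtain ⟨p, d, rfl⟩ : ∃ p' d, p = p' ++ [d] := by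
      rcases List.eq_nil_or_concat p with rfl | h
      · simp at hne
      · simpa using h
    exact ⟨d, _, hx, p, by simp⟩
  · rintro ⟨d, x, hx, h⟩
    refine ⟨x, hx, (List.suffix_cons d y).trans h, ?_⟩
    rintro rfl
    exact not_cons_suffix_self d y h

/-! ### Abstract states and their simulation -/

/-- Abstract states of the automaton for the hinted language: the words of the dictionary and the
part of the current word that has been read. -/
inductive RecSpec : Type where
  | start
  | closed (xs : List Node) (k : ℕ)
  | reading (xs : List Node) (u : Node) (d : Side)
  | skip (xs : List Node)
  | look (xs : List Node) (u : Node)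
  | stackSkip
  | stackPush (u : Node)
  | stackPop (u : Node)
  | stackEnd
  | dead

open Classical in
/-- Transitions of the abstract states. -/
noncomputable def RecSpec.step : RecSpec → HintedSymbol → RecSpec
  | .start, .hint1 => .closed [] 0
  | .start, .hint2 => .stackSkip
  | .closed xs 0, .sym s =>
    match s.toSide, s with
    | some d, _ => .reading xs [] d
    | none, .cent => .skip xs
    | none, _ => .dead
  | .closed xs (k + 1), .sym .dollar => .closed xs k
  | .reading xs u d, .sym s =>
    match s.toSide, s with
    | some e, _ => .reading xs (d :: u) e
    | none, .dollar =>
      if ProperlyOnPath xs (d :: u) then .dead else .closed ((d :: u) :: xs) u.length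
    | none, _ => .dead
  | .skip xs, .sym s =>
    match s.toSide, s with
    | some _, _ => .skip xs
    | none, .dollar => .skip xs
    | none, .border1 => .look xs []
    | none, _ => .dead
  | .look xs u, .sym s =>
    match s.toSide with
    | some d => if OnPath xs (d :: u) then .look xs (d :: u) else .dead
    | none => .dead
  | .stackSkip, .sym s =>
    match s.toSide, s with
    | some _, _ => .stackSkip
    | none, .dollar => .stackSkip
    | none, .cent => .stackPush []
    | none, _ => .dead
  | .stackPush u, .sym s =>
    match s.toSide, s with
    | some d, _ => .stackPush (d :: u)
    | none, .dollar => .stackPop u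
    | none, _ => .dead
  | .stackPop u, .sym s =>
    match s.toSide, s with
    | some d, _ => if u.head? = some d then .stackPop u.tail else .dead
    | none, .border2 => if u.head? = none then .stackEnd else .dead
    | none, _ => .dead
  | _, _ => .dead

/-- Accepting abstract states. -/
def RecSpec.Accepting : RecSpec → Prop
  | .look xs u => u = [] ∨ u ∈ xs
  | .stackEnd => True
  | _ => False

/-- The configurations that implement an abstract state. -/
def RecSpec.Implements : RecSpec → Snap RecState (Bool × Bool) → Prop
  | .start, c => c = ⟨.start, trie [] [], []⟩
  | .closed xs k, c => ∃ fresh P, c = ⟨.climb fresh, trie xs [], P⟩ ∧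
      ((P = [] ∧ k = 0) ∨ (P.length = k + 1 ∧ OnPath xs P)) ∧
      (fresh = true → ∀ d, ¬ OnPath xs (d :: P))
  | .reading xs u d, c => c = ⟨.word d, trie xs u, u⟩
  | .skip xs, c => c = ⟨.skip, trie xs [], []⟩
  | .look xs u, c => c = ⟨.look, trie xs [], u⟩ ∧ (u = [] ∨ OnPath xs u)
  | .stackSkip, c => c = ⟨.stackSkip, trie [] [], []⟩
  | .stackPush u, c => c = ⟨.stackPush, trie [] u, u⟩
  | .stackPop u, c => ∃ v, u <:+ v ∧ c = ⟨.stackPop, trie [] v, u⟩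
  | .stackEnd, c => ∃ v, c = ⟨.stackEnd, trie [] v, []⟩
  | .dead, c => ∃ xs P d, OnPath xs (d :: P) ∧ c = ⟨.climb true, trie xs [], P⟩

theorem TWSDA.next_of_label {α Q Γ : Type} (M : TWSDA α Q Γ) {c : Snap Q Γ} {x : Option Γ}
    (hx : c.tree c.pointer = some x) (s : InputSymbol α) :
    M.next c s = (M.δ c.state (some s) (nodeType c.tree c.pointer) x).map fun p =>
      ⟨p.1, (p.2.apply c.tree c.pointer).1, (p.2.apply c.tree c.pointer).2⟩ := by
  simp [TWSDA.next, hx]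

theorem nodeType_has {Γ : Type} (T : Labelling Γ) (P : Node) (d : Side) :
    (nodeType T P).has d = (T (d :: P)).isSome := by
  cases d <;> rfl

theorem apply_upAction {Γ : Type} (T T' : Labelling Γ) (P : Node) :
    (upAction (nodeType T' P) : StorageAction Γ).apply T P = (T, P.tail) := by
  cases P <;> simp [upAction, nodeType, StorageAction.apply]

theorem has_trie_iff {xs : List Node} {u : Node} {d : Side} :
    (nodeType (trie xs u) u).has d = true ↔ OnPath xs (d :: u) := by
  rw [nodeType_has, isSome_trie_cons]
  simp [not_cons_suffix_self]

theorem apply_enterAction_path {xs : List Node} {u : Node} (d : Side) :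
    (enterAction (nodeType (trie xs u) u) d ((nodeType (trie xs u) u).pos.isNone, false)).apply
      (trie xs u) u = (trie xs (d :: u), d :: u) := by
  unfold enterAction
  split
  · rename_i h
    rw [StorageAction.apply, trie_cons_of_onPath (has_trie_iff.1 h)]
  · rename_i h
    rw [StorageAction.apply, ← update_trie_path fun h' => h (has_trie_iff.2 h')]
    rfl

theorem apply_enterAction_end {xs : List Node} {u : Node} {d : Side} (h : ¬ OnPath xs (d :: u)) :
    (enterAction (nodeType (trie xs u) u) d ((nodeType (trie xs u) u).pos.isNone, true)).apply
      (trie xs u) u = (trie ((d :: u) :: xs) [], d :: u) := by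
  rw [enterAction, if_neg (fun h' => h (has_trie_iff.1 h')), StorageAction.apply,
    ← update_trie_end h]
  rfl

theorem isSome_trie_self (xs : List Node) (u : Node) : ∃ x, trie xs u u = some x := by
  cases u with
  | nil => exact ⟨_, trie_nil _ _⟩
  | cons d u => exact ⟨_, trie_cons (Or.inr List.suffix_rfl)⟩

theorem hasChild_iff {xs : List Node} {P : Node} :
    ((nodeType (trie xs []) P).hasLeft || (nodeType (trie xs []) P).hasRight) = true ↔
      ∃ d, OnPath xs (d :: P) := by
  have h : ∀ d, (trie xs [] (d :: P)).isSome ↔ OnPath xs (d :: P) := fun d => by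
    simp [isSome_trie_cons]
  rw [Bool.or_eq_true]
  change (trie xs [] (Side.l :: P)).isSome = true ∨ (trie xs [] (Side.r :: P)).isSome = true ↔ _
  rw [h, h]
  constructor
  · rintro (h | h) <;> exact ⟨_, h⟩
  · rintro ⟨d, h⟩
    cases d <;> tauto

theorem next_hintedAutomaton {q : RecState} {T : Labelling (Bool × Bool)} {P : Node}
    {x : Option (Bool × Bool)} (hx : T P = some x) (s : HintedSymbol) :
    hintedAutomaton.next ⟨q, T, P⟩ (.letter s) = (recLetter q s (nodeType T P) x).map fun p =>
      ⟨p.1, (p.2.apply T P).1, (p.2.apply T P).2⟩ :=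
  hintedAutomaton.next_of_label (c := ⟨q, T, P⟩) hx _

theorem next_hintedAutomaton_end {q : RecState} {T : Labelling (Bool × Bool)} {P : Node}
    {x : Option (Bool × Bool)} (hx : T P = some x) :
    hintedAutomaton.next ⟨q, T, P⟩ .endmarker = (recEnd q x).map fun p =>
      ⟨p.1, (p.2.apply T P).1, (p.2.apply T P).2⟩ :=
  hintedAutomaton.next_of_label (c := ⟨q, T, P⟩) hx _

/-- Reading `s` in configuration `c` leads to an implementation of `p`, or the word is rejected
by both. -/
def StepsTo (c : Snap RecState (Bool × Bool)) (s : HintedSymbol) (p : RecSpec) : Prop :=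
  (∃ c', hintedAutomaton.next c (.letter s) = some c' ∧ p.Implements c') ∨
    (hintedAutomaton.next c (.letter s) = none ∧ p = .dead)

theorem stepsTo_start (s : HintedSymbol) :
    StepsTo ⟨.start, trie [] [], []⟩ s (RecSpec.start.step s) := by
  unfold StepsTo
  rw [next_hintedAutomaton (trie_nil _ _)]
  cases s
  · exact Or.inr ⟨rfl, rfl⟩
  · exact Or.inl ⟨_, rfl, false, [], rfl, Or.inl ⟨rfl, rfl⟩, by simp⟩
  · exact Or.inl ⟨_, rfl, rfl⟩

theorem stepsTo_skip (xs : List Node) (s : HintedSymbol) :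
    StepsTo ⟨.skip, trie xs [], []⟩ s ((RecSpec.skip xs).step s) := by
  unfold StepsTo
  rw [next_hintedAutomaton (trie_nil _ _)]
  rcases s with s | _ | _
  · cases s
    · exact Or.inl ⟨_, rfl, rfl⟩
    · exact Or.inl ⟨_, rfl, rfl⟩
    · exact Or.inl ⟨_, rfl, rfl⟩
    · exact Or.inr ⟨rfl, rfl⟩
    · exact Or.inl ⟨_, rfl, rfl, Or.inl rfl⟩
    · exact Or.inr ⟨rfl, rfl⟩
  · exact Or.inr ⟨rfl, rfl⟩
  · exact Or.inr ⟨rfl, rfl⟩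

theorem stepsTo_stackSkip (s : HintedSymbol) :
    StepsTo ⟨.stackSkip, trie [] [], []⟩ s (RecSpec.stackSkip.step s) := by
  unfold StepsTo
  rw [next_hintedAutomaton (trie_nil _ _)]
  rcases s with s | _ | _
  · cases s
    · exact Or.inl ⟨_, rfl, rfl⟩
    · exact Or.inl ⟨_, rfl, rfl⟩
    · exact Or.inl ⟨_, rfl, rfl⟩
    · exact Or.inl ⟨_, rfl, rfl⟩
    · exact Or.inr ⟨rfl, rfl⟩
    · exact Or.inr ⟨rfl, rfl⟩
  · exact Or.inr ⟨rfl, rfl⟩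
  · exact Or.inr ⟨rfl, rfl⟩

theorem stepsTo_stackEnd (v : Node) (s : HintedSymbol) :
    StepsTo ⟨.stackEnd, trie [] v, []⟩ s (RecSpec.stackEnd.step s) := by
  unfold StepsTo
  rw [next_hintedAutomaton (trie_nil _ _)]
  rcases s with s | _ | _ <;> exact Or.inr ⟨rfl, rfl⟩

theorem stepsTo_stackPush (u : Node) (s : HintedSymbol) :
    StepsTo ⟨.stackPush, trie [] u, u⟩ s ((RecSpec.stackPush u).step s) := by
  obtain ⟨x, hx⟩ := isSome_trie_self [] u
  have henter : ∀ d, hintedAutomaton.next ⟨.stackPush, trie [] u, u⟩ (.letter (.sym d.toBase)) =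
      some ⟨.stackPush, trie [] (d :: u), d :: u⟩ := by
    intro d
    rw [next_hintedAutomaton hx]
    have := apply_enterAction_path (xs := []) (u := u) d
    cases d <;> simp [recLetter, Side.toBase, BaseSymbol.toSide, this]
  rcases s with s | _ | _
  · cases s
    · exact Or.inl ⟨_, henter Side.l, rfl⟩
    · exact Or.inl ⟨_, henter Side.r, rfl⟩
    · exact Or.inl ⟨_, by rw [next_hintedAutomaton hx]; rfl, u, List.suffix_rfl, rfl⟩
    all_goals exact Or.inr ⟨by rw [next_hintedAutomaton hx]; rfl, rfl⟩
  all_goals exact Or.inr ⟨by rw [next_hintedAutomaton hx]; rfl, rfl⟩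

/-- Since nothing is popped, the whole path `v` stays in the tree while the pointer is at its
ancestor `u`; the side of the current node is the letter to be compared. -/
theorem stepsTo_stackPop {u v : Node} (huv : u <:+ v) (s : HintedSymbol) :
    StepsTo ⟨.stackPop, trie [] v, u⟩ s ((RecSpec.stackPop u).step s) := by
  obtain ⟨x, hx⟩ : ∃ x, trie [] v u = some x := by
    cases u with
    | nil => exact ⟨_, trie_nil _ _⟩
    | cons d u => exact ⟨_, trie_cons (Or.inr huv)⟩
  have hup : ∀ d, StepsTo ⟨.stackPop, trie [] v, u⟩ (.sym d.toBase)
      (if u.head? = some d then .stackPop u.tail else .dead) := by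
    intro d
    unfold StepsTo
    rw [next_hintedAutomaton hx]
    have hpos : (nodeType (trie [] v) u).pos = u.head? := rfl
    by_cases h : u.head? = some d
    · left
      refine ⟨⟨.stackPop, trie [] v, u.tail⟩, ?_, ?_⟩
      · cases d <;> simp [recLetter, Side.toBase, BaseSymbol.toSide, hpos, h, apply_upAction]
      · rw [if_pos h]
        exact ⟨v, (List.tail_suffix u).trans huv, rfl⟩
    · right
      refine ⟨?_, if_neg h⟩
      cases d <;> simp [recLetter, Side.toBase, BaseSymbol.toSide, hpos, h]
  rcases s with s | _ | _
  · cases s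
    · exact hup Side.l
    · exact hup Side.r
    · exact Or.inr ⟨by rw [next_hintedAutomaton hx]; rfl, rfl⟩
    · exact Or.inr ⟨by rw [next_hintedAutomaton hx]; rfl, rfl⟩
    · exact Or.inr ⟨by rw [next_hintedAutomaton hx]; rfl, rfl⟩
    · cases u with
      | nil => exact Or.inl ⟨_, by rw [next_hintedAutomaton hx]; rfl, v, rfl⟩
      | cons d u => exact Or.inr ⟨by rw [next_hintedAutomaton hx]; rfl, rfl⟩
  all_goals exact Or.inr ⟨by rw [next_hintedAutomaton hx]; rfl, rfl⟩

theorem isSome_trie_of {xs : List Node} {v u : Node} (h : u = [] ∨ OnPath xs u) :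
    ∃ x, trie xs v u = some x := by
  cases u with
  | nil => exact ⟨_, trie_nil _ _⟩
  | cons d u => exact ⟨_, trie_cons (Or.inl (h.resolve_left (by simp)))⟩

theorem stepsTo_look {xs : List Node} {u : Node} (hu : u = [] ∨ OnPath xs u) (s : HintedSymbol) :
    StepsTo ⟨.look, trie xs [], u⟩ s ((RecSpec.look xs u).step s) := by
  classical
  obtain ⟨x, hx⟩ := isSome_trie_of (v := []) hu
  have hhas : ∀ d, (nodeType (trie xs []) u).has d = true ↔ OnPath xs (d :: u) := by
    intro d
    rw [nodeType_has, isSome_trie_cons]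
    simp
  have hdown : ∀ d, StepsTo ⟨.look, trie xs [], u⟩ (.sym d.toBase)
      (if OnPath xs (d :: u) then .look xs (d :: u) else .dead) := by
    intro d
    unfold StepsTo
    rw [next_hintedAutomaton hx]
    by_cases h : OnPath xs (d :: u)
    · left
      refine ⟨⟨.look, trie xs [], d :: u⟩, ?_, ?_⟩
      · have := (hhas d).2 h
        cases d <;> simp [recLetter, Side.toBase, BaseSymbol.toSide, this, enterAction,
          StorageAction.apply]
      · rw [if_pos h]
        exact ⟨rfl, Or.inr h⟩
    · right
      refine ⟨?_, if_neg h⟩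
      have : ¬ _ := fun h' => h ((hhas d).1 h')
      cases d <;> simp [recLetter, Side.toBase, BaseSymbol.toSide, this]
  rcases s with s | _ | _
  · cases s
    · exact hdown Side.l
    · exact hdown Side.r
    all_goals exact Or.inr ⟨by rw [next_hintedAutomaton hx]; rfl, rfl⟩
  all_goals exact Or.inr ⟨by rw [next_hintedAutomaton hx]; rfl, rfl⟩

/-- The critical symbol is `$`, which stores the pending last letter. The node is new, or the end of
an equal earlier word, or an inner node that makes the current word a forbidden prefix. -/
theorem stepsTo_reading (xs : List Node) (u : Node) (d : Side) (s : HintedSymbol) :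
    StepsTo ⟨.word d, trie xs u, u⟩ s ((RecSpec.reading xs u d).step s) := by
  obtain ⟨x, hx⟩ := isSome_trie_self xs u
  have henter : ∀ e, hintedAutomaton.next ⟨.word d, trie xs u, u⟩ (.letter (.sym e.toBase)) =
      some ⟨.word e, trie xs (d :: u), d :: u⟩ := by
    intro e
    rw [next_hintedAutomaton hx]
    have := apply_enterAction_path (xs := xs) (u := u) d
    cases e <;> simp [recLetter, Side.toBase, BaseSymbol.toSide, this]
  rcases s with s | _ | _
  · cases s
    · exact Or.inl ⟨_, henter Side.l, rfl⟩
    · exact Or.inl ⟨_, henter Side.r, rfl⟩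
    · left
      rw [next_hintedAutomaton hx]
      by_cases hpath : OnPath xs (d :: u)
      · have htree : trie xs u = trie xs [] := by
          have := trie_path_of_onPath hpath.of_cons
          exact this
        refine ⟨⟨.climb true, trie xs u, d :: u⟩, ?_, ?_⟩
        · simp [recLetter, BaseSymbol.toSide, enterAction, has_trie_iff.2 hpath,
            StorageAction.apply]
        · by_cases hprop : ProperlyOnPath xs (d :: u)
          · have hstep : (RecSpec.reading xs u d).step (.sym .dollar) = .dead := by
              simp [RecSpec.step, BaseSymbol.toSide, hprop]
            rw [hstep]
            -- The automaton still makes this step, but in `climb true` at a node with a descendant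
            -- it is stuck, which is how `dead` is implemented.
            obtain ⟨e, he⟩ := properlyOnPath_iff.1 hprop
            exact ⟨xs, d :: u, e, he, by rw [htree]⟩
          · have hstep : (RecSpec.reading xs u d).step (.sym .dollar) =
                .closed ((d :: u) :: xs) u.length := by
              simp [RecSpec.step, BaseSymbol.toSide, hprop]
            rw [hstep]
            have hmem : d :: u ∈ xs := by
              obtain ⟨y, hy, hsuf⟩ := hpath
              by_contra hne
              exact hprop ⟨y, hy, hsuf, fun h => hne (h ▸ hy)⟩
            refine ⟨true, d :: u, by rw [trie_end_of_mem hmem],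
              Or.inr ⟨rfl, _, List.mem_cons_self, List.suffix_rfl⟩, fun _ e he => ?_⟩
            rcases onPath_cons.1 he with he | he
            · exact not_cons_suffix_self _ _ he
            · exact hprop (properlyOnPath_iff.2 ⟨e, he⟩)
      · refine ⟨⟨.climb true, trie ((d :: u) :: xs) [], d :: u⟩, ?_, ?_⟩
        · have := apply_enterAction_end hpath
          simp [recLetter, BaseSymbol.toSide, this]
        · have hprop : ¬ ProperlyOnPath xs (d :: u) := fun ⟨y, hy, hsuf, _⟩ => hpath ⟨y, hy, hsuf⟩
          have hstep : (RecSpec.reading xs u d).step (.sym .dollar) =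
              .closed ((d :: u) :: xs) u.length := by
            simp [RecSpec.step, BaseSymbol.toSide, hprop]
          rw [hstep]
          refine ⟨true, d :: u, rfl, Or.inr ⟨rfl, _, List.mem_cons_self, List.suffix_rfl⟩,
            fun _ e he => ?_⟩
          rcases onPath_cons.1 he with he | he
          · exact not_cons_suffix_self _ _ he
          · exact hpath he.of_cons
    all_goals exact Or.inr ⟨by rw [next_hintedAutomaton hx]; rfl, rfl⟩
  all_goals exact Or.inr ⟨by rw [next_hintedAutomaton hx]; rfl, rfl⟩

/-- From depth `k + 1`, the `k` remaining dollars lead to depth one, and the next letter or ¢ makes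
the last move to the root. Together with the `$` that stored the last letter this is exactly the
length of the word; the first label component recognises depth one. -/
theorem stepsTo_closed {xs : List Node} {k : ℕ} {fresh : Bool} {P : Node}
    (hP : (P = [] ∧ k = 0) ∨ (P.length = k + 1 ∧ OnPath xs P))
    (hfresh : fresh = true → ∀ d, ¬ OnPath xs (d :: P)) (s : HintedSymbol) :
    StepsTo ⟨.climb fresh, trie xs [], P⟩ s ((RecSpec.closed xs k).step s) := by
  obtain ⟨x, hx, htop⟩ : ∃ x, trie xs [] P = some x ∧
      ((x = none ∨ x.map Prod.fst = some true) ↔ k = 0) := by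
    rcases hP with ⟨rfl, rfl⟩ | ⟨hk, hP⟩
    · exact ⟨_, trie_nil _ _, by simp⟩
    · cases P with
      | nil => simp at hk
      | cons d P =>
        refine ⟨_, trie_cons (Or.inl hP), ?_⟩
        simp only [List.length_cons, Nat.add_right_cancel_iff] at hk
        cases P <;> simp at hk <;> simp <;> omega
  have hleaf : (fresh && ((nodeType (trie xs []) P).hasLeft ||
      (nodeType (trie xs []) P).hasRight)) = false := by
    cases fresh with
    | false => rfl
    | true =>
      rw [Bool.true_and]
      refine Bool.eq_false_iff.2 fun h => ?_
      obtain ⟨d, hd⟩ := hasChild_iff.1 h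
      exact hfresh rfl d hd
  unfold StepsTo
  rw [next_hintedAutomaton hx]
  cases k with
  | zero =>
    have htop0 := htop.2 rfl
    have htail : P.tail = [] := by
      rcases hP with ⟨rfl, -⟩ | ⟨hk, -⟩
      · rfl
      · exact List.length_eq_zero_iff.1 (by simp [hk])
    rcases s with s | _ | _
    · cases s
      · exact Or.inl ⟨⟨.word Side.l, trie xs [], []⟩,
          by simp only [recLetter, hleaf, htop0, BaseSymbol.toSide, apply_upAction, htail,
            Bool.false_eq_true, if_false, if_true, Option.map_some], rfl⟩
      · exact Or.inl ⟨⟨.word Side.r, trie xs [], []⟩,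
          by simp only [recLetter, hleaf, htop0, BaseSymbol.toSide, apply_upAction, htail,
            Bool.false_eq_true, if_false, if_true, Option.map_some], rfl⟩
      · exact Or.inr ⟨by simp only [recLetter, hleaf, htop0, BaseSymbol.toSide,
            Bool.false_eq_true, if_false, if_true, Option.map_none], rfl⟩
      · exact Or.inl ⟨⟨.skip, trie xs [], []⟩,
          by simp only [recLetter, hleaf, htop0, BaseSymbol.toSide, apply_upAction, htail,
            Bool.false_eq_true, if_false, if_true, Option.map_some], rfl⟩
      · exact Or.inr ⟨by simp only [recLetter, hleaf, htop0, BaseSymbol.toSide,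
            Bool.false_eq_true, if_false, if_true, Option.map_none], rfl⟩
      · exact Or.inr ⟨by simp only [recLetter, hleaf, htop0, BaseSymbol.toSide,
            Bool.false_eq_true, if_false, if_true, Option.map_none], rfl⟩
    all_goals exact Or.inr ⟨rfl, rfl⟩
  | succ k =>
    have htop0 : ¬ _ := fun h => Nat.succ_ne_zero k (htop.1 h)
    rcases s with s | _ | _
    · cases s
      · exact Or.inr ⟨by simp only [recLetter, hleaf, htop0,
            Bool.false_eq_true, if_false, Option.map_none], rfl⟩
      · exact Or.inr ⟨by simp only [recLetter, hleaf, htop0,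
            Bool.false_eq_true, if_false, Option.map_none], rfl⟩
      · refine Or.inl ⟨⟨.climb false, trie xs [], P.tail⟩,
          by simp only [recLetter, hleaf, htop0, apply_upAction,
            Bool.false_eq_true, if_false, Option.map_some], false, P.tail, rfl, Or.inr ?_,
          by simp⟩
        obtain ⟨hk, hP⟩ := hP.resolve_left (by simp)
        cases P with
        | nil => simp at hk
        | cons d P => exact ⟨by simpa using hk, hP.of_cons⟩
      all_goals exact Or.inr ⟨by simp only [recLetter, hleaf, htop0,
            Bool.false_eq_true, if_false, Option.map_none], rfl⟩
    all_goals exact Or.inr ⟨rfl, rfl⟩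

theorem stepsTo_dead {xs : List Node} {P : Node} {d : Side} (h : OnPath xs (d :: P))
    (s : HintedSymbol) : StepsTo ⟨.climb true, trie xs [], P⟩ s (RecSpec.dead.step s) := by
  obtain ⟨x, hx⟩ := isSome_trie_of (v := []) (Or.inr h.of_cons)
  have hchild := hasChild_iff.2 ⟨d, h⟩
  refine Or.inr ⟨?_, rfl⟩
  rw [next_hintedAutomaton hx]
  rcases s with s | _ | _
  · simp only [recLetter, hchild, Bool.true_and, if_true, Option.map_none]
  all_goals rfl

theorem RecSpec.Implements.stepsTo {p : RecSpec} {c : Snap RecState (Bool × Bool)}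
    (h : p.Implements c) (s : HintedSymbol) : StepsTo c s (p.step s) := by
  cases p with
  | start => obtain rfl := h; exact stepsTo_start s
  | closed xs k =>
    obtain ⟨fresh, P, rfl, hP, hfresh⟩ := h
    exact stepsTo_closed hP hfresh s
  | reading xs u d => obtain rfl := h; exact stepsTo_reading xs u d s
  | skip xs => obtain rfl := h; exact stepsTo_skip xs s
  | look xs u => obtain ⟨rfl, hu⟩ := h; exact stepsTo_look hu s
  | stackSkip => obtain rfl := h; exact stepsTo_stackSkip s
  | stackPush u => obtain rfl := h; exact stepsTo_stackPush u s
  | stackPop u => obtain ⟨v, huv, rfl⟩ := h; exact stepsTo_stackPop huv s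
  | stackEnd => obtain ⟨v, rfl⟩ := h; exact stepsTo_stackEnd v s
  | dead => obtain ⟨xs, P, d, hd, rfl⟩ := h; exact stepsTo_dead hd s

theorem RecSpec.Implements.acceptsFrom_end_iff {p : RecSpec} {c : Snap RecState (Bool × Bool)}
    (h : p.Implements c) : hintedAutomaton.AcceptsFrom c [.endmarker] ↔ p.Accepting := by
  classical
  have hrej : ∀ {q T P} {x : Option (Bool × Bool)}, T P = some x → recEnd q x = none →
      ¬ hintedAutomaton.AcceptsFrom ⟨q, T, P⟩ [.endmarker] := by
    rintro q T P x hx hq hacc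
    obtain ⟨c', hc', -⟩ := hintedAutomaton.acceptsFrom_cons.1 hacc
    rw [next_hintedAutomaton_end hx, hq] at hc'
    cases hc'
  have hacc : ∀ {q T P} {x : Option (Bool × Bool)}, T P = some x →
      recEnd q x = some (.accept, .stay) →
      hintedAutomaton.AcceptsFrom ⟨q, T, P⟩ [.endmarker] := by
    rintro q T P x hx hq
    refine hintedAutomaton.acceptsFrom_cons.2
      ⟨_, by rw [next_hintedAutomaton_end hx, hq]; rfl, _, rfl,
        by simp [hintedAutomaton]⟩
  cases p with
  | start => obtain rfl := h; exact iff_of_false (hrej (trie_nil _ _) rfl) id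
  | closed xs k =>
    obtain ⟨fresh, P, rfl, hP, -⟩ := h
    obtain ⟨x, hx⟩ := isSome_trie_of (v := []) (hP.imp And.left And.right)
    exact iff_of_false (hrej hx rfl) id
  | reading xs u d =>
    obtain rfl := h
    obtain ⟨x, hx⟩ := isSome_trie_self xs u
    exact iff_of_false (hrej hx rfl) id
  | skip xs => obtain rfl := h; exact iff_of_false (hrej (trie_nil _ _) rfl) id
  | look xs u =>
    obtain ⟨rfl, hu⟩ := h
    cases u with
    | nil => exact iff_of_true (hacc (trie_nil _ _) (by simp [recEnd])) (Or.inl rfl)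
    | cons d u =>
      have hx := trie_cons (u := []) (Or.inl (hu.resolve_left (by simp)))
      by_cases hmem : d :: u ∈ xs
      · exact iff_of_true (hacc hx (by simp [recEnd, hmem])) (Or.inr hmem)
      · exact iff_of_false (hrej hx (by simp [recEnd, hmem])) (by simp [Accepting, hmem])
  | stackSkip => obtain rfl := h; exact iff_of_false (hrej (trie_nil _ _) rfl) id
  | stackPush u =>
    obtain rfl := h
    obtain ⟨x, hx⟩ := isSome_trie_self [] u
    exact iff_of_false (hrej hx rfl) id
  | stackPop u =>
    obtain ⟨v, huv, rfl⟩ := h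
    refine iff_of_false ?_ id
    cases u with
    | nil => exact hrej (trie_nil _ _) rfl
    | cons d u => exact hrej (trie_cons (Or.inr huv)) rfl
  | stackEnd => obtain ⟨v, rfl⟩ := h; exact iff_of_true (hacc (trie_nil _ _) rfl) trivial
  | dead =>
    obtain ⟨xs, P, d, hd, rfl⟩ := h
    obtain ⟨x, hx⟩ := isSome_trie_of (v := []) (Or.inr hd.of_cons)
    exact iff_of_false (hrej hx rfl) id

theorem RecSpec.foldl_step_dead (w : List HintedSymbol) : w.foldl RecSpec.step .dead = .dead := by
  induction w with
  | nil => rfl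
  | cons s w ih => exact ih

theorem RecSpec.Implements.acceptsFrom_iff {p : RecSpec} {c : Snap RecState (Bool × Bool)}
    (h : p.Implements c) (w : List HintedSymbol) :
    hintedAutomaton.AcceptsFrom c (withEnd w) ↔ (w.foldl RecSpec.step p).Accepting := by
  induction w generalizing p c with
  | nil => exact h.acceptsFrom_end_iff
  | cons s w ih =>
    change hintedAutomaton.AcceptsFrom c (.letter s :: withEnd w) ↔ _
    rw [hintedAutomaton.acceptsFrom_cons, List.foldl_cons]
    rcases h.stepsTo s with ⟨c', hc', hp⟩ | ⟨hc, hp⟩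
    · rw [← ih hp, hc']
      simp
    · rw [hp, foldl_step_dead, hc]
      simp [Accepting]

theorem mem_accepted_hintedAutomaton_iff (w : List HintedSymbol) :
    w ∈ hintedAutomaton.accepted ↔ (w.foldl RecSpec.step .start).Accepting := by
  rw [hintedAutomaton.mem_accepted_iff hintedAutomaton_realTime]
  refine RecSpec.Implements.acceptsFrom_iff (p := .start) ?_ w
  change hintedAutomaton.initSnap = _
  simp only [TWSDA.initSnap, hintedAutomaton, Snap.mk.injEq, true_and, and_true]
  funext P
  by_cases hP : P = []
  · simp [hP, trie_nil]
  · simp [hP, trie, OnPath]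

/-! ### Languages of the abstract states -/

/-- The word that leads from the root to a node. -/
def nodeWord (y : Node) : List BaseSymbol := y.reverse.map Side.toBase

theorem IsWordAB.exists_map_toBase {x : List BaseSymbol} (h : IsWordAB x) :
    ∃ v : List Side, x = v.map Side.toBase := by
  induction x with
  | nil => exact ⟨[], rfl⟩
  | cons s x ih =>
    obtain ⟨v, rfl⟩ := ih fun t ht => h t (List.mem_cons_of_mem _ ht)
    rcases h s List.mem_cons_self with rfl | rfl
    · exact ⟨Side.l :: v, rfl⟩
    · exact ⟨Side.r :: v, rfl⟩

theorem exists_map_nodeWord {xs : List (List BaseSymbol)} (h : ∀ x ∈ xs, IsWordAB x) :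
    ∃ ys : List Node, xs = ys.map nodeWord := by
  induction xs with
  | nil => exact ⟨[], rfl⟩
  | cons x xs ih =>
    obtain ⟨ys, rfl⟩ := ih fun y hy => h y (List.mem_cons_of_mem _ hy)
    obtain ⟨v, rfl⟩ := (h x List.mem_cons_self).exists_map_toBase
    exact ⟨v.reverse :: ys, by simp [nodeWord]⟩

theorem isWordAB_nodeWord (y : Node) : IsWordAB (nodeWord y) := isWordAB_map_toBase _

theorem nodeWord_injective : Function.Injective nodeWord := fun _ _ h =>
  List.reverse_injective (List.map_injective_iff.2 Side.toBase_injective h)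

theorem nodeWord_prefix_iff {y z : Node} : nodeWord y <+: nodeWord z ↔ y <:+ z := by
  rw [nodeWord, nodeWord, List.prefix_map_iff_of_injective Side.toBase_injective,
    List.reverse_prefix]

theorem length_nodeWord (y : Node) : (nodeWord y).length = y.length := by simp [nodeWord]

/-- The words of `ys` can be added to the dictionary `xs` one after the other. -/
def Admissible (xs ys : List Node) : Prop :=
  (∀ y ∈ ys, ¬ ProperlyOnPath xs y) ∧ ys.Pairwise fun yj yi => ¬ (yi <:+ yj ∧ yi ≠ yj)

/-- The conditions between `y` and the later words become conditions on the enlarged dictionary, so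
the words can be processed one at a time. -/
theorem admissible_cons {xs ys : List Node} {y : Node} :
    Admissible xs (y :: ys) ↔ ¬ ProperlyOnPath xs y ∧ Admissible (y :: xs) ys := by
  have h : ∀ z, ProperlyOnPath (y :: xs) z ↔ (z <:+ y ∧ z ≠ y) ∨ ProperlyOnPath xs z := by
    intro z
    simp only [ProperlyOnPath, List.exists_mem_cons_iff]
  simp only [Admissible, List.forall_mem_cons, List.pairwise_cons, h, not_or, forall_and]
  tauto

/-- Words read after `#₁`. -/
def LookLang (xs : List Node) (u : Node) (w : List BaseSymbol) : Prop :=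
  ∃ v : List Side, w = v.map Side.toBase ∧ (v.reverse ++ u = [] ∨ v.reverse ++ u ∈ xs)

/-- Words read after `¢` in the first branch. -/
def SkipLang (xs : List Node) (w : List BaseSymbol) : Prop :=
  ∃ z w', IsWordABDollar z ∧ w = z ++ BaseSymbol.border1 :: w' ∧ LookLang xs [] w'

/-- Words read between two words of the dictionary. -/
def ClosedLang (xs : List Node) (w : List BaseSymbol) : Prop :=
  ∃ ys w', (∀ y ∈ ys, y ≠ []) ∧ Admissible xs ys ∧
    w = dollarCode (ys.map nodeWord) ++ BaseSymbol.cent :: w' ∧ SkipLang (ys.reverse ++ xs) w'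

/-- Words read inside a word of the dictionary. -/
def ReadingLang (xs : List Node) (u : Node) (d : Side) (w : List BaseSymbol) : Prop :=
  ∃ (v : List Side) (w' : List BaseSymbol), ¬ ProperlyOnPath xs (v.reverse ++ d :: u) ∧
    w = v.map Side.toBase ++
      (List.replicate (v.length + u.length + 1) BaseSymbol.dollar ++ w') ∧
    ClosedLang ((v.reverse ++ d :: u) :: xs) w'

/-- The words accepted from an abstract state other than the start. -/
def RecSpec.Lang : RecSpec → List BaseSymbol → Prop
  | .start, _ => True
  | .closed xs k, w => ∃ w', w = List.replicate k BaseSymbol.dollar ++ w' ∧ ClosedLang xs w'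
  | .reading xs u d, w => ReadingLang xs u d w
  | .skip xs, w => SkipLang xs w
  | .look xs u, w => LookLang xs u w
  | .stackSkip, w => ∃ (x : List BaseSymbol) (v : List Side), IsWordABDollar x ∧
      w = x ++ BaseSymbol.cent :: (v.map Side.toBase ++ BaseSymbol.dollar ::
        (v.reverse.map Side.toBase ++ [BaseSymbol.border2]))
  | .stackPush u, w => ∃ v : List Side, w = v.map Side.toBase ++ BaseSymbol.dollar ::
        ((v.reverse ++ u).map Side.toBase ++ [BaseSymbol.border2])
  | .stackPop u, w => w = u.map Side.toBase ++ [BaseSymbol.border2]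
  | .stackEnd, w => w = []
  | .dead, _ => False

theorem ReadingLang.closedLang {xs : List Node} {d : Side} {w : List BaseSymbol}
    (h : ReadingLang xs [] d w) : ClosedLang xs (d.toBase :: w) := by
  obtain ⟨v, w', hprop, rfl, ys, w'', hne, hadm, rfl, hskip⟩ := h
  refine ⟨(v.reverse ++ [d]) :: ys, w'', ?_, admissible_cons.2 ⟨hprop, hadm⟩, ?_, ?_⟩
  · intro y hy
    rcases List.mem_cons.1 hy with rfl | hy
    · simp
    · exact hne y hy
  · rw [List.map_cons, dollarCode_cons, length_nodeWord]
    simp [nodeWord]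
  · simpa using hskip

theorem ReadingLang.cons {xs : List Node} {u : Node} {d e : Side} {w : List BaseSymbol}
    (h : ReadingLang xs (d :: u) e w) : ReadingLang xs u d (e.toBase :: w) := by
  obtain ⟨v, w', hprop, rfl, h⟩ := h
  refine ⟨e :: v, w', by simpa using hprop, ?_, by simpa using h⟩
  simp only [List.map_cons, List.length_cons, List.cons_append]
  rw [show v.length + (u.length + 1) + 1 = v.length + 1 + u.length + 1 by omega]

theorem IsWordABDollar.cons {s : BaseSymbol} {x : List BaseSymbol} (h : IsWordABDollar x)
    (hs : s = .a ∨ s = .b ∨ s = .dollar) : IsWordABDollar (s :: x) := by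
  intro t ht
  rcases List.mem_cons.1 ht with rfl | ht
  · exact hs
  · exact h t ht

theorem SkipLang.cons {xs : List Node} {s : BaseSymbol} {w : List BaseSymbol}
    (h : SkipLang xs w) (hs : s = .a ∨ s = .b ∨ s = .dollar) : SkipLang xs (s :: w) := by
  obtain ⟨z, w', hz, rfl, h⟩ := h
  exact ⟨s :: z, w', hz.cons hs, rfl, h⟩

theorem LookLang.cons {xs : List Node} {u : Node} {d : Side} {w : List BaseSymbol}
    (h : LookLang xs (d :: u) w) : LookLang xs u (d.toBase :: w) := by
  obtain ⟨v, rfl, h⟩ := h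
  exact ⟨d :: v, rfl, by simpa using h⟩

/-- The inductive step of soundness, read from the end of the input: a word good for the successor
stays good when `s` is prepended. Forbidden symbols lead to `dead`, whose language is empty; for
`start` nothing is claimed. -/
theorem RecSpec.Lang.of_step {p : RecSpec} {s : BaseSymbol} {w : List BaseSymbol}
    (h : (p.step (.sym s)).Lang w) : p.Lang (s :: w) := by
  classical
  cases p with
  | start => trivial
  | closed xs k =>
    cases k with
    | zero =>
      refine ⟨s :: w, rfl, ?_⟩
      cases s with
      | a => exact ReadingLang.closedLang (d := Side.l) h
      | b => exact ReadingLang.closedLang (d := Side.r) h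
      | cent => exact ⟨[], w, by simp, ⟨by simp, by simp⟩, rfl, h⟩
      | dollar => exact h.elim
      | border1 => exact h.elim
      | border2 => exact h.elim
    | succ k =>
      cases s with
      | dollar =>
        obtain ⟨w', rfl, h⟩ := h
        exact ⟨w', rfl, h⟩
      | a => exact h.elim
      | b => exact h.elim
      | cent => exact h.elim
      | border1 => exact h.elim
      | border2 => exact h.elim
  | reading xs u d =>
    cases s with
    | a => exact ReadingLang.cons (e := Side.l) h
    | b => exact ReadingLang.cons (e := Side.r) h
    | dollar =>
      by_cases hprop : ProperlyOnPath xs (d :: u)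
      · simp [step, BaseSymbol.toSide, hprop, Lang] at h
      · simp only [step, BaseSymbol.toSide, hprop, if_false] at h
        obtain ⟨w', rfl, h⟩ := h
        exact ⟨[], w', hprop, by simp [List.replicate_succ], h⟩
    | cent => exact h.elim
    | border1 => exact h.elim
    | border2 => exact h.elim
  | skip xs =>
    cases s with
    | a => exact SkipLang.cons h (Or.inl rfl)
    | b => exact SkipLang.cons h (Or.inr (Or.inl rfl))
    | dollar => exact SkipLang.cons h (Or.inr (Or.inr rfl))
    | border1 => exact ⟨[], w, by simp [IsWordABDollar], rfl, h⟩
    | cent => exact h.elim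
    | border2 => exact h.elim
  | look xs u =>
    have hstep : ∀ d : Side,
        (if OnPath xs (d :: u) then RecSpec.look xs (d :: u) else .dead).Lang w →
        LookLang xs u (d.toBase :: w) := by
      intro d h
      split at h
      · exact LookLang.cons h
      · exact h.elim
    cases s with
    | a => exact hstep Side.l h
    | b => exact hstep Side.r h
    | dollar => exact h.elim
    | border1 => exact h.elim
    | cent => exact h.elim
    | border2 => exact h.elim
  | stackSkip =>
    cases s with
    | a => obtain ⟨x, v, hx, rfl⟩ := h; exact ⟨_ :: x, v, hx.cons (Or.inl rfl), rfl⟩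
    | b => obtain ⟨x, v, hx, rfl⟩ := h; exact ⟨_ :: x, v, hx.cons (Or.inr (Or.inl rfl)), rfl⟩
    | dollar => obtain ⟨x, v, hx, rfl⟩ := h; exact ⟨_ :: x, v, hx.cons (Or.inr (Or.inr rfl)), rfl⟩
    | cent =>
      obtain ⟨v, rfl⟩ := h
      exact ⟨[], v, by simp [IsWordABDollar], by simp⟩
    | border1 => exact h.elim
    | border2 => exact h.elim
  | stackPush u =>
    cases s with
    | a => obtain ⟨v, rfl⟩ := h; exact ⟨Side.l :: v, by simp [Side.toBase]⟩
    | b => obtain ⟨v, rfl⟩ := h; exact ⟨Side.r :: v, by simp [Side.toBase]⟩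
    | dollar => exact ⟨[], by rw [show w = _ from h]; simp⟩
    | cent => exact h.elim
    | border1 => exact h.elim
    | border2 => exact h.elim
  | stackPop u =>
    have hstep : ∀ d : Side,
        (if u.head? = some d then RecSpec.stackPop u.tail else .dead).Lang w →
        d.toBase :: w = u.map Side.toBase ++ [BaseSymbol.border2] := by
      intro d h
      split at h
      · rename_i hd
        rw [show w = _ from h]
        cases u with
        | nil => simp at hd
        | cons e u => simp at hd; simp [hd]
      · exact h.elim
    cases s with
    | a => exact hstep Side.l h
    | b => exact hstep Side.r h
    | border2 =>
      cases u with
      | nil => rw [show w = _ from h]; rfl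
      | cons e u => exact h.elim
    | dollar => exact h.elim
    | cent => exact h.elim
    | border1 => exact h.elim
  | stackEnd => exact h.elim
  | dead => exact h.elim

theorem RecSpec.lang_of_accepting {p : RecSpec} {w : List BaseSymbol}
    (h : ((w.map HintedSymbol.sym).foldl step p).Accepting) : p.Lang w := by
  induction w generalizing p with
  | nil =>
    cases p with
    | start => trivial
    | look xs u => exact ⟨[], rfl, h⟩
    | stackEnd => rfl
    | _ => exact h.elim
  | cons s w ih => exact Lang.of_step (ih h)

theorem RecSpec.step_ne_start (p : RecSpec) (s : HintedSymbol) : p.step s ≠ .start := by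
  unfold step
  split <;> (try split) <;> (try split) <;> simp

theorem RecSpec.step_hint {p : RecSpec} (hp : p ≠ .start) {s : HintedSymbol}
    (hs : ∀ t, s ≠ .sym t) : p.step s = .dead := by
  rcases s with s | _ | _
  · exact absurd rfl (hs s)
  · cases p with
    | start => exact absurd rfl hp
    | closed xs k => cases k <;> rfl
    | _ => rfl
  · cases p with
    | start => exact absurd rfl hp
    | closed xs k => cases k <;> rfl
    | _ => rfl

/-- A hint after the first symbol leads to `dead`, from which no word is accepted. -/
theorem RecSpec.exists_map_sym {p : RecSpec} (hp : p ≠ .start) {w : List HintedSymbol}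
    (h : (w.foldl step p).Accepting) : ∃ v : List BaseSymbol, w = v.map HintedSymbol.sym := by
  induction w generalizing p with
  | nil => exact ⟨[], rfl⟩
  | cons s w ih =>
    by_cases hs : ∃ t, s = .sym t
    · obtain ⟨t, rfl⟩ := hs
      obtain ⟨v, rfl⟩ := ih (step_ne_start p _) h
      exact ⟨t :: v, rfl⟩
    · rw [List.foldl_cons, step_hint hp (fun t ht => hs ⟨t, ht⟩), foldl_step_dead] at h
      exact h.elim

/-- The abstract state after reading a word without hints. -/
noncomputable def RecSpec.read (p : RecSpec) (w : List BaseSymbol) : RecSpec :=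
  (w.map HintedSymbol.sym).foldl step p

theorem RecSpec.read_append (p : RecSpec) (u w : List BaseSymbol) :
    p.read (u ++ w) = (p.read u).read w := by
  simp [read]

theorem RecSpec.read_cons (p : RecSpec) (s : BaseSymbol) (w : List BaseSymbol) :
    p.read (s :: w) = (p.step (.sym s)).read w := rfl

theorem RecSpec.read_replicate_dollar (xs : List Node) (k : ℕ) :
    (closed xs k).read (List.replicate k BaseSymbol.dollar) = closed xs 0 := by
  induction k with
  | zero => rfl
  | succ k ih => exact ih

/-- The stored part `u`, the pending letter `d` and the rest `v` together have as many letters as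
there are dollars; the first dollar stores the last letter and the others are counted down. -/
theorem RecSpec.read_reading {xs : List Node} {v : List Side} {u : Node} {d : Side}
    (h : ¬ ProperlyOnPath xs (v.reverse ++ d :: u)) :
    (reading xs u d).read (v.map Side.toBase ++
      List.replicate (v.length + u.length + 1) BaseSymbol.dollar) =
      closed ((v.reverse ++ d :: u) :: xs) 0 := by
  induction v generalizing u d with
  | nil =>
    rw [List.reverse_nil, List.nil_append] at h ⊢
    simp only [List.map_nil, List.nil_append, List.length_nil, Nat.zero_add, List.replicate_succ,
      read_cons, step, BaseSymbol.toSide, h, if_false]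
    exact read_replicate_dollar _ _
  | cons e v ih =>
    have := ih (u := d :: u) (d := e) (by simpa using h)
    simp only [List.map_cons, List.cons_append, read_cons, List.reverse_cons, List.append_assoc,
      List.length_cons, List.nil_append] at this ⊢
    rw [← this, show v.length + 1 + u.length + 1 = v.length + (u.length + 1) + 1 by omega]
    cases e <;> rfl

theorem RecSpec.read_dollarCode {xs ys : List Node} (hne : ∀ y ∈ ys, y ≠ [])
    (h : Admissible xs ys) :
    (closed xs 0).read (dollarCode (ys.map nodeWord)) = closed (ys.reverse ++ xs) 0 := by
  induction ys generalizing xs with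
  | nil => rfl
  | cons y ys ih =>
    obtain ⟨hy, h⟩ := admissible_cons.1 h
    have hrest := ih (fun z hz => hne z (List.mem_cons_of_mem _ hz)) h
    obtain ⟨v, d, rfl⟩ : ∃ v d, y = List.reverse v ++ [d] := by
      rcases List.eq_nil_or_concat y with rfl | ⟨v, d, rfl⟩
      · exact absurd rfl (hne [] List.mem_cons_self)
      · exact ⟨v.reverse, d, by simp⟩
    rw [List.map_cons, dollarCode_cons, read_append, length_nodeWord]
    have hfirst : (closed xs 0).read (nodeWord (v.reverse ++ [d]) ++
        List.replicate (v.reverse ++ [d]).length BaseSymbol.dollar) =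
        closed ((v.reverse ++ [d]) :: xs) 0 := by
      rw [← read_reading hy]
      have : nodeWord (v.reverse ++ [d]) = d.toBase :: v.map Side.toBase := by simp [nodeWord]
      rw [this, List.cons_append, read_cons]
      cases d <;> simp [step, Side.toBase, BaseSymbol.toSide]
    rw [hfirst, hrest]
    simp

theorem RecSpec.read_skip {xs : List Node} {z : List BaseSymbol} (hz : IsWordABDollar z) :
    (skip xs).read z = skip xs := by
  induction z with
  | nil => rfl
  | cons s z ih =>
    rw [read_cons]
    have := ih fun t ht => hz t (List.mem_cons_of_mem _ ht)
    rcases hz s List.mem_cons_self with rfl | rfl | rfl <;> exact this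

/-- All prefixes of a dictionary word are nodes of the trie, so no descent fails. -/
theorem RecSpec.read_look {xs : List Node} {v : List Side} {u : Node}
    (h : v.reverse ++ u = [] ∨ v.reverse ++ u ∈ xs) :
    (look xs u).read (v.map Side.toBase) = look xs (v.reverse ++ u) := by
  induction v generalizing u with
  | nil => rfl
  | cons d v ih =>
    have hmem : v.reverse ++ d :: u ∈ xs := by simpa using h
    have hpath : OnPath xs (d :: u) := ⟨_, hmem, List.suffix_append _ _⟩
    have := ih (u := d :: u) (Or.inr hmem)
    rw [List.map_cons, read_cons, List.reverse_cons, List.append_assoc, List.singleton_append,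
      ← this]
    cases d <;> simp [step, Side.toBase, BaseSymbol.toSide, hpath]

theorem RecSpec.accepting_of_closedLang {w : List BaseSymbol} (h : ClosedLang [] w) :
    ((closed [] 0).read w).Accepting := by
  obtain ⟨ys, w', hne, hadm, rfl, z, w'', hz, rfl, v, rfl, hv⟩ := h
  rw [read_append, read_dollarCode hne hadm, read_cons]
  change ((skip _).read _).Accepting
  rw [read_append, read_skip hz, read_cons]
  change ((look _ []).read _).Accepting
  rw [read_look hv]
  exact hv

theorem RecSpec.read_stackSkip {x : List BaseSymbol} (hx : IsWordABDollar x) :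
    stackSkip.read x = stackSkip := by
  induction x with
  | nil => rfl
  | cons s x ih =>
    rw [read_cons]
    have := ih fun t ht => hx t (List.mem_cons_of_mem _ ht)
    rcases hx s List.mem_cons_self with rfl | rfl | rfl <;> exact this

theorem RecSpec.read_stackPush (v : List Side) (u : Node) :
    (stackPush u).read (v.map Side.toBase) = stackPush (v.reverse ++ u) := by
  induction v generalizing u with
  | nil => rfl
  | cons d v ih =>
    have := ih (d :: u)
    rw [List.map_cons, read_cons, List.reverse_cons, List.append_assoc, List.singleton_append,
      ← this]
    cases d <;> rfl

theorem RecSpec.read_stackPop (u : Node) :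
    (stackPop u).read (u.map Side.toBase ++ [BaseSymbol.border2]) = stackEnd := by
  induction u with
  | nil => rfl
  | cons d u ih =>
    rw [List.map_cons, List.cons_append, read_cons, ← ih]
    cases d <;> simp [step, Side.toBase, BaseSymbol.toSide]

/-- The two descriptions differ only in empty dictionary words, which the automaton cannot see. They
may be dropped from the list or added in front, and accordingly `LookLang` always admits the empty
query. -/
theorem mem_hatLp_iff {w : List BaseSymbol} : w ∈ hatLp ↔ ClosedLang [] w := by
  classical
  constructor
  · rintro ⟨xs, z, y, hxs, hz, hpw, hy, rfl⟩
    obtain ⟨ys, rfl⟩ := exists_map_nodeWord hxs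
    obtain ⟨y, hymem, rfl⟩ := List.mem_map.1 hy
    rw [List.pairwise_map] at hpw
    have hcode : ∀ ys : List Node, dollarCode (ys.map nodeWord) =
        dollarCode ((ys.filter fun y => decide (y ≠ [])).map nodeWord) := by
      intro ys
      induction ys with
      | nil => rfl
      | cons y ys ih =>
        by_cases hy : y = []
        · subst hy
          rw [List.map_cons, dollarCode_cons, ih]
          simp [nodeWord]
        · rw [List.filter_cons_of_pos (by simpa using hy), List.map_cons, List.map_cons,
            dollarCode_cons, dollarCode_cons, ih]
    refine ⟨ys.filter fun y => decide (y ≠ []), z ++ BaseSymbol.border1 :: nodeWord y, ?_,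
      ⟨?_, ?_⟩, ?_, z, nodeWord y, hz, rfl, y.reverse, rfl, ?_⟩
    · intro y hy
      simpa using (List.mem_filter.1 hy).2
    · rintro y - ⟨x, hx, -⟩
      simp at hx
    · refine (hpw.imp ?_).filter _
      rintro yj yi h ⟨h1, h2⟩
      exact h ⟨nodeWord_prefix_iff.2 h1, fun he => h2 (nodeWord_injective he)⟩
    · rw [← hcode]
      change dollarCode _ ++ _ ++ _ ++ _ ++ _ = _
      simp
    · by_cases hy0 : y = []
      · exact Or.inl (by simp [hy0])
      · exact Or.inr (by simp [hymem, hy0])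
  · rintro ⟨ys, w', hne, hadm, rfl, z, w'', hz, rfl, v, rfl, hv⟩
    -- The empty word is put first to cover an empty query; no word precedes it there, so it is not
    -- a proper prefix of an earlier one.
    refine ⟨[] :: ys.map nodeWord, z, v.map Side.toBase, ?_, hz, ?_, ?_, ?_⟩
    · intro x hx
      rcases List.mem_cons.1 hx with rfl | hx
      · simp [IsWordAB]
      · obtain ⟨y, -, rfl⟩ := List.mem_map.1 hx
        exact isWordAB_nodeWord y
    · rw [List.pairwise_cons, List.pairwise_map]
      refine ⟨fun x _ h => h.2 (List.prefix_nil.1 h.1), hadm.2.imp ?_⟩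
      rintro yj yi h ⟨h1, h2⟩
      exact h ⟨nodeWord_prefix_iff.1 h1, fun he => h2 (by rw [he])⟩
    · rcases hv with hv | hv
      · have : v = [] := by simpa using hv
        simp [this]
      · refine List.mem_cons_of_mem _ (List.mem_map.2 ⟨v.reverse, by simpa using hv, ?_⟩)
        simp [nodeWord]
    · change _ = dollarCode _ ++ _ ++ _ ++ _ ++ _
      rw [dollarCode_cons]
      simp

theorem mem_hatLmi_iff {w : List BaseSymbol} : w ∈ hatLmi ↔ RecSpec.stackSkip.Lang w := by
  constructor
  · rintro ⟨x, v, hx, hv, rfl⟩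
    obtain ⟨v, rfl⟩ := hv.exists_map_toBase
    exact ⟨x, v, hx, by simp⟩
  · rintro ⟨x, v, hx, rfl⟩
    exact ⟨x, _, hx, isWordAB_map_toBase v, by simp⟩

theorem RecSpec.accepting_of_stackLang {w : List BaseSymbol} (h : stackSkip.Lang w) :
    (stackSkip.read w).Accepting := by
  obtain ⟨x, v, hx, rfl⟩ := h
  rw [read_append, read_stackSkip hx, read_cons]
  change ((stackPush []).read _).Accepting
  rw [read_append, read_stackPush, read_cons, List.append_nil]
  change ((stackPop _).read _).Accepting
  rw [read_stackPop]
  trivial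

theorem accepted_hintedAutomaton : hintedAutomaton.accepted = hintedLanguage := by
  ext w
  rw [mem_accepted_hintedAutomaton_iff]
  constructor
  · intro h
    cases w with
    | nil => exact h.elim
    | cons s w =>
      rw [List.foldl_cons] at h
      rcases s with s | _ | _
      · rw [show RecSpec.start.step (.sym s) = .dead from rfl, RecSpec.foldl_step_dead] at h
        exact h.elim
      · rw [show RecSpec.start.step .hint1 = .closed [] 0 from rfl] at h
        obtain ⟨v, rfl⟩ := RecSpec.exists_map_sym (by simp) h
        obtain ⟨v', rfl, hv⟩ := RecSpec.lang_of_accepting h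
        exact Or.inl ⟨_, mem_hatLp_iff.2 hv, rfl⟩
      · rw [show RecSpec.start.step .hint2 = .stackSkip from rfl] at h
        obtain ⟨v, rfl⟩ := RecSpec.exists_map_sym (by simp) h
        exact Or.inr ⟨_, mem_hatLmi_iff.2 (RecSpec.lang_of_accepting h), rfl⟩
  · rintro (⟨u, hu, rfl⟩ | ⟨u, hu, rfl⟩)
    · exact RecSpec.accepting_of_closedLang (mem_hatLp_iff.1 hu)
    · exact RecSpec.accepting_of_stackLang (mem_hatLmi_iff.1 hu)

/-! ### Conclusion for both families -/

theorem hintedLanguage_mem_rtTWSDNEA : hintedLanguage ∈ rtTWSDNEA HintedSymbol :=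
  ⟨RecState, Bool × Bool, inferInstance, inferInstance, hintedAutomaton,
    hintedAutomaton_nonErasing, hintedAutomaton_realTime, accepted_hintedAutomaton⟩

theorem rtTWSDNEA_subset_rtTWSDA (α : Type) : rtTWSDNEA α ⊆ rtTWSDA α := by
  rintro L ⟨Q, Γ, hQ, hΓ, M, -, hM, hL⟩
  exact ⟨Q, Γ, hQ, hΓ, M, hM, hL⟩

theorem lengthPreserving_mergeHints : LengthPreserving mergeHints := by
  intro w
  exact List.length_map (f := mergeSymbol) (as := FreeMonoid.toList w)

instance : Finite BaseSymbol := by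
  refine Set.finite_univ_iff.1 (Set.Finite.subset
    (Set.toFinite ({.a, .b, .dollar, .cent, .border1, .border2} : Set BaseSymbol)) ?_)
  intro s _
  cases s <;> simp

instance : Finite HintedSymbol := by
  refine Set.finite_univ_iff.1 (Set.Finite.subset
    ((Set.finite_range HintedSymbol.sym).union
      (Set.toFinite ({.hint1, .hint2} : Set HintedSymbol))) ?_)
  intro s _
  cases s <;> simp

instance : Finite MergedSymbol := by
  refine Set.finite_univ_iff.1 (Set.Finite.subset
    ((Set.finite_range MergedSymbol.sym).union
      (Set.toFinite ({.hint} : Set MergedSymbol))) ?_)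
  intro s _
  cases s <;> simp

theorem mainTheorem11 :
    ¬ ClosedUnderLengthPreservingHom rtTWSDA ∧
    ¬ ClosedUnderLengthPreservingHom rtTWSDNEA ∧
    LengthPreserving mergeHints ∧
    hintedLanguage ∈ rtTWSDNEA HintedSymbol ∧
    hintedLanguage ∈ rtTWSDA HintedSymbol ∧
    homImage mergeHints hintedLanguage ∉ rtTWSDA MergedSymbol ∧
    homImage mergeHints hintedLanguage ∉ rtTWSDNEA MergedSymbol := by
  have hnea := hintedLanguage_mem_rtTWSDNEA
  have hda := rtTWSDNEA_subset_rtTWSDA _ hnea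
  have hnot := homImage_mergeHints_notMem_rtTWSDA
  have hnot' : homImage mergeHints hintedLanguage ∉ rtTWSDNEA MergedSymbol :=
    fun h => hnot (rtTWSDNEA_subset_rtTWSDA _ h)
  have hlen := lengthPreserving_mergeHints
  exact ⟨fun h => hnot (h _ _ mergeHints hlen _ hda), fun h => hnot' (h _ _ mergeHints hlen _ hnea),
    hlen, hnea, hda, hnot, hnot'⟩
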